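/- Let $N\ge 1$ be an integer, $0<\alpha<1$, $\lambda\in\mathbb C\setminus\{0\}$, $-\frac{\pi}{2}\le\theta\le\frac{\pi}{2}$, and suppose that $s>3+\frac N2+\alpha$. Let $H^s(\mathbb R^N)$ denote the Sobolev space of complex-valued functions $u\in L^2(\mathbb R^N)$ with finite norm $\|u\|_{H^s}=\|\mathcal F^{-1}[(1+|\xi|^2)^{s/2}\widehat u\,]\|_{L^2}$. Then there exists $\varphi\in C_c^\infty(\mathbb R^N)$ (complex-valued) such that there is no $T>0$ for which there exists a solution $u\in C([0,T],H^s(\mathbb R^N))$ of the complex Ginzburg–Landau equation $$\begin{cases}u_t=e^{i\theta}\Delta u+\lambda|u|^\alpha u,\\ u(0)=\varphi.\end{cases}$$ Here $u\in C([0,T],H^s(\mathbb R^N))$ is called a solution if $u(0)=\varphi$ and the equation holds in the sense of tempered distributions on $\mathbb R^N$ for every $t\in(0,T)$, i.e. for every Schwartz function $\psi$ the map $t\mapsto\int_{\mathbb R^N}u(t)\psi\,dx$ is differentiable on $(0,T)$ with derivative $e^{i\theta}\langle\Delta u(t),\psi\rangle+\lambda\int_{\mathbb R^N}|u(t)|^\alpha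 u(t)\,\psi\,dx$. -/

import Mathlib

open scoped ContDiff SchwartzMap Laplacian

noncomputable section

namespace GinzburgLandau

open MeasureTheory TemperedDistribution

/-- The space `L²(ℝᴺ)` of complex-valued functions. -/
abbrev L2 (N : ℕ) : Type := Lp ℂ 2 (volume : Measure (EuclideanSpace ℝ (Fin N)))

/-- The functions `u ∈ L²(ℝᴺ)` with `𝓕⁻¹ [(1 + |ξ|²)^(s/2) 𝓕 u] ∈ L²(ℝᴺ)`, as a subspace of
`L²(ℝᴺ)`. For `s ≥ 0` this is the set of all tempered distributions of Sobolev regularity `s`. -/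
def sobolevSubmodule (N : ℕ) (s : ℝ) : Submodule ℂ (L2 N) where
  carrier := {u | MemSobolev s 2 (Lp.toTemperedDistribution u)}
  add_mem' {u v} hu hv := by
    have h := MemSobolev.add hu hv
    simpa only [Set.mem_ofPred_eq, ← Lp.toTemperedDistributionCLM_apply, map_add] using h
  zero_mem' := by
    simp only [Set.mem_ofPred_eq, ← Lp.toTemperedDistributionCLM_apply, map_zero]
    exact memSobolev_fun_zero _ _ s 2
  smul_mem' c u hu := by
    have h := MemSobolev.smul c hu
    simpa only [Set.mem_ofPred_eq, ← Lp.toTemperedDistributionCLM_apply, map_smul] using h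

/-- The Sobolev space `Hˢ(ℝᴺ)`, `s ≥ 0`. It is a type of its own, so that it carries the
`Hˢ`-norm below and not the norm of `L²`. -/
def SobolevSpace (N : ℕ) (s : ℝ) : Type := sobolevSubmodule N s

namespace SobolevSpace

variable {N : ℕ} {s : ℝ}

instance : AddCommGroup (SobolevSpace N s) :=
  inferInstanceAs (AddCommGroup (sobolevSubmodule N s))

instance : Module ℂ (SobolevSpace N s) :=
  inferInstanceAs (Module ℂ (sobolevSubmodule N s))

/-- The inclusion `Hˢ(ℝᴺ) ⊆ L²(ℝᴺ)`. -/
def toL2 : SobolevSpace N s →ₗ[ℂ] L2 N := (sobolevSubmodule N s).subtype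

theorem toL2_injective : Function.Injective (toL2 : SobolevSpace N s → L2 N) :=
  Subtype.val_injective

theorem toTemperedDistribution_injective :
    Function.Injective (fun f : L2 N => Lp.toTemperedDistribution f) :=
  LinearMap.ker_eq_bot.mp (Lp.ker_toTemperedDistributionCLM_eq_bot (F := ℂ) (p := 2)
    (μ := (volume : Measure (EuclideanSpace ℝ (Fin N)))))

theorem exists_bessel (u : SobolevSpace N s) :
    ∃ f : L2 N, besselPotential (EuclideanSpace ℝ (Fin N)) ℂ s
      (Lp.toTemperedDistribution (toL2 u)) = Lp.toTemperedDistribution f :=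
  u.2

/-- The `L²` function `𝓕⁻¹ [(1 + |ξ|²)^(s/2) 𝓕 u]`. -/
def besselFun (u : SobolevSpace N s) : L2 N := (exists_bessel u).choose

theorem besselFun_spec (u : SobolevSpace N s) :
    besselPotential (EuclideanSpace ℝ (Fin N)) ℂ s (Lp.toTemperedDistribution (toL2 u)) =
      Lp.toTemperedDistribution (besselFun u) :=
  (exists_bessel u).choose_spec

/-- The map `u ↦ 𝓕⁻¹ [(1 + |ξ|²)^(s/2) 𝓕 u]` from `Hˢ(ℝᴺ)` to `L²(ℝᴺ)`. -/
def bessel : SobolevSpace N s →ₗ[ℂ] L2 N where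
  toFun := besselFun
  map_add' u v := by
    apply toTemperedDistribution_injective
    have hu := besselFun_spec u
    have hv := besselFun_spec v
    have huv := besselFun_spec (u + v)
    simp only [← Lp.toTemperedDistributionCLM_apply, map_add] at hu hv huv ⊢
    rw [← huv, hu, hv]
  map_smul' c u := by
    apply toTemperedDistribution_injective
    have hu := besselFun_spec u
    have hcu := besselFun_spec (c • u)
    simp only [← Lp.toTemperedDistributionCLM_apply, map_smul, RingHom.id_apply] at hu hcu ⊢
    rw [← hcu, hu]

theorem bessel_injective : Function.Injective (bessel : SobolevSpace N s → L2 N) := by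
  intro u v h
  have hu := besselFun_spec u
  have hv := besselFun_spec v
  rw [show besselFun u = besselFun v from h, ← hv] at hu
  apply toL2_injective
  apply toTemperedDistribution_injective
  have h2 := congrArg (besselPotential (EuclideanSpace ℝ (Fin N)) ℂ (-s)) hu
  simpa using h2

/-- `‖u‖_{Hˢ} = ‖𝓕⁻¹ [(1 + |ξ|²)^(s/2) 𝓕 u]‖_{L²}`. The Fourier transform is the one with kernel
`exp(-2πi⟨x,ξ⟩)`; the other conventions give equivalent norms on the same space. -/
instance : NormedAddCommGroup (SobolevSpace N s) :=
  NormedAddCommGroup.induced (SobolevSpace N s) (L2 N) bessel bessel_injective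

instance : NormedSpace ℂ (SobolevSpace N s) :=
  NormedSpace.induced ℂ (SobolevSpace N s) (L2 N) bessel

theorem norm_def (u : SobolevSpace N s) : ‖u‖ = ‖bessel u‖ := rfl

end SobolevSpace

/-- `u ∈ C([0,T], Hˢ(ℝᴺ))` is a solution on `[0,T]` of the complex Ginzburg-Landau equation
`∂ₜ u = e^{iθ} Δ u + λ |u|^α u`, `u(0) = φ`. The equation is required to hold in the sense of
tempered distributions on `ℝᴺ` for every `t ∈ (0,T)`: for all `ψ ∈ 𝓢(ℝᴺ)`,
`d/dt ⟨u(t), ψ⟩ = e^{iθ} ⟨Δ u(t), ψ⟩ + λ ∫ |u(t,x)|^α u(t,x) ψ(x) dx`.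
The values of `u` outside `[0,T]` play no role. -/
structure IsSolution (N : ℕ) (s α θ : ℝ) (lam : ℂ) (φ : EuclideanSpace ℝ (Fin N) → ℂ) (T : ℝ)
    (u : ℝ → SobolevSpace N s) : Prop where
  continuousOn : ContinuousOn u (Set.Icc 0 T)
  equation : ∀ t ∈ Set.Ioo 0 T, ∀ ψ : 𝓢(EuclideanSpace ℝ (Fin N), ℂ),
    HasDerivAt (fun τ : ℝ => Lp.toTemperedDistribution (u τ).toL2 ψ)
      (Complex.exp (Complex.I * θ) * (Δ (Lp.toTemperedDistribution (u t).toL2)) ψ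
        + lam * ∫ x, ((‖(u t).toL2 x‖ ^ α : ℝ) : ℂ) * (u t).toL2 x * ψ x) t
  initial : (u 0).toL2 =ᵐ[volume] φ

end GinzburgLandau

end

/-! The function `z ↦ |z|^α z` is only of class `C^{1,α}` at `0`. If `u(t)` vanishes at the origin
with a nonzero differential `ℓ`, then `|u|^α u` behaves there like `|ℓ|^α ℓ`, which is homogeneous
of degree `1 + α`. On the other hand, `s > 3 + N/2 + α` leaves room for some `β > α` such that
`u(t)` and `Δu(t)` both have a first order Taylor expansion at the origin with remainder
`O(|x|^(1+β))`, uniformly in `t`. The equation, integrated in time, cannot balance these two orders.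

The initial value is an odd function equal to a coordinate near the origin. Oddness persists: the
even part `u + u(-·)` satisfies an energy inequality, since `e^{iθ}Δ` is dissipative and the
nonlinearity is odd and Lipschitz on bounded sets (`IsSolution.add_reflect_eq_zero`). Hence `u(t,0)
= 0` on the whole interval.

The orders are compared through `scalePairing`. For odd `χ` it annihilates constants, by parity, and
linear maps, since `ℓ(hy) - 2ℓ(hy/2) = 0`. It is therefore `O(h^(1+β))` on `u` and `Δu`
(`norm_scalePairing_le`), while on `|u|^α u` it equals `h^(1+α) (1 - 2^(-α)) ∫ χ |ℓ|^α ℓ` up to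
`O(h^(1+β))` (`norm_scalePairing_powerNonlinearity_sub_le`). For small times the last integral stays
close to its nonzero initial value, so integrating over a short time interval forces `a h^(1+α) ≤ C
h^(1+β)` with `a > 0` for all `h ∈ (0,1]`, which is absurd (`not_isSolution_of_odd`). -/

noncomputable section

namespace GinzburgLandau

open MeasureTheory TemperedDistribution FourierTransform Filter Topology
open scoped InnerProductSpace ENNReal

/-! ### Pointwise estimates: the power nonlinearity and the exponential -/

/-- The power nonlinearity `z ↦ |z|^α z`. -/
def powerNonlinearity (α : ℝ) (z : ℂ) : ℂ := ((‖z‖ ^ α : ℝ) : ℂ) * z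

theorem norm_powerNonlinearity {α : ℝ} (z : ℂ) :
    ‖powerNonlinearity α z‖ = ‖z‖ ^ α * ‖z‖ := by
  rw [powerNonlinearity, norm_mul, Complex.norm_real, Real.norm_of_nonneg (by positivity)]

theorem powerNonlinearity_neg (α : ℝ) (z : ℂ) :
    powerNonlinearity α (-z) = -powerNonlinearity α z := by
  simp [powerNonlinearity]

theorem powerNonlinearity_ofReal_mul (α : ℝ) {h : ℝ} (hh : 0 < h) (z : ℂ) :
    powerNonlinearity α (h * z) = ((h ^ (1 + α) : ℝ) : ℂ) * powerNonlinearity α z := by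
  simp only [powerNonlinearity, norm_mul, Complex.norm_real, Real.norm_of_nonneg hh.le]
  rw [Real.mul_rpow hh.le (norm_nonneg _), Real.rpow_add hh, Real.rpow_one]
  push_cast
  ring

theorem continuous_powerNonlinearity {α : ℝ} (hα : 0 ≤ α) :
    Continuous (powerNonlinearity α) := by
  unfold powerNonlinearity
  exact (Complex.continuous_ofReal.comp
    (continuous_norm.rpow_const fun _ => Or.inr hα)).mul continuous_id

/-- With `|w| ≤ |z|`, the difference splits as `|z|^α (z - w) + (|z|^α - |w|^α) w`, and each term is
at most `|z|^α |z - w|`. -/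
theorem norm_powerNonlinearity_sub_le {α M : ℝ} (hα : 0 < α) (hα₁ : α ≤ 1) {z w : ℂ}
    (hz : ‖z‖ ≤ M) (hw : ‖w‖ ≤ M) :
    ‖powerNonlinearity α z - powerNonlinearity α w‖ ≤ 2 * M ^ α * ‖z - w‖ := by
  wlog h : ‖w‖ ≤ ‖z‖ generalizing z w
  · rw [norm_sub_rev, norm_sub_rev z w]
    exact this hw hz (le_of_not_ge h)
  -- After scaling by `t = |w|/|z|` this is `(1 - t^α) t ≤ 1 - t`, true because `t ≤ t^α` for `α ≤
  -- 1`.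
  have key : (‖z‖ ^ α - ‖w‖ ^ α) * ‖w‖ ≤ ‖z‖ ^ α * (‖z‖ - ‖w‖) := by
    rcases (norm_nonneg z).eq_or_lt with h0 | h0
    · have : ‖w‖ = 0 := le_antisymm (h0 ▸ h) (norm_nonneg _)
      simp [← h0, this]
    obtain ⟨t, ht⟩ : ∃ t, t = ‖w‖ / ‖z‖ := ⟨_, rfl⟩
    have ht0 : 0 ≤ t := ht ▸ by positivity
    have ht1 : t ≤ 1 := ht ▸ div_le_one_of_le₀ h h0.le
    have hwt : ‖w‖ = t * ‖z‖ := by rw [ht]; field_simp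
    have htα : t ≤ t ^ α := by
      simpa using Real.rpow_le_rpow_of_exponent_ge' ht0 ht1 hα.le hα₁
    have h1 : (1 - t ^ α) * t ≤ 1 - t := by nlinarith
    rw [hwt, Real.mul_rpow ht0 h0.le]
    have := mul_le_mul_of_nonneg_left h1 (by positivity : 0 ≤ ‖z‖ ^ α * ‖z‖)
    linarith
  have hmono : ‖w‖ ^ α ≤ ‖z‖ ^ α := Real.rpow_le_rpow (norm_nonneg _) h hα.le
  have e : powerNonlinearity α z - powerNonlinearity α w =
      ((‖z‖ ^ α : ℝ) : ℂ) * (z - w) + ((‖z‖ ^ α - ‖w‖ ^ α : ℝ) : ℂ) * w := by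
    simp only [powerNonlinearity]; push_cast; ring
  rw [e]
  refine (norm_add_le _ _).trans ?_
  rw [norm_mul, norm_mul, Complex.norm_real, Complex.norm_real,
    Real.norm_of_nonneg (by positivity), Real.norm_of_nonneg (sub_nonneg.2 hmono)]
  have h2 : ‖z‖ - ‖w‖ ≤ ‖z - w‖ := norm_sub_norm_le _ _
  have h3 : ‖z‖ ^ α ≤ M ^ α := Real.rpow_le_rpow (norm_nonneg _) hz hα.le
  have h4 : 0 ≤ ‖z‖ ^ α := by positivity
  calc ‖z‖ ^ α * ‖z - w‖ + (‖z‖ ^ α - ‖w‖ ^ α) * ‖w‖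
      ≤ ‖z‖ ^ α * ‖z - w‖ + ‖z‖ ^ α * ‖z - w‖ :=
        add_le_add le_rfl (key.trans (mul_le_mul_of_nonneg_left h2 h4))
    _ = 2 * ‖z‖ ^ α * ‖z - w‖ := by ring
    _ ≤ _ := by gcongr

/-- Interpolates between the quadratic Taylor bound for `|r| ≤ 1` and the trivial bound `2 + |r|`
for `|r| > 1`; the latter gives the constant 3. -/
theorem norm_exp_mul_I_sub_one_sub_le {β : ℝ} (hβ₀ : 0 ≤ β) (hβ₁ : β ≤ 1) (r : ℝ) :
    ‖Complex.exp (r * Complex.I) - 1 - r * Complex.I‖ ≤ 3 * |r| ^ (1 + β) := by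
  have hn : ‖(r * Complex.I : ℂ)‖ = |r| := by simp
  rcases le_or_gt |r| 1 with h | h
  · refine (Complex.norm_exp_sub_one_sub_id_le (hn.trans_le h)).trans ?_
    rw [hn]
    have : |r| ^ (2 : ℝ) ≤ |r| ^ (1 + β) :=
      Real.rpow_le_rpow_of_exponent_ge' (abs_nonneg _) h (by linarith) (by linarith)
    rw [Real.rpow_two] at this
    have h0 : 0 ≤ |r| ^ (1 + β) := by positivity
    linarith
  · have h1 : ‖Complex.exp (r * Complex.I) - 1 - r * Complex.I‖ ≤ 1 + 1 + |r| := by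
      refine (norm_sub_le _ _).trans (add_le_add ((norm_sub_le _ _).trans ?_) hn.le)
      simp [Complex.norm_exp_ofReal_mul_I]
    have h2 : |r| ≤ |r| ^ (1 + β) := by
      simpa using Real.rpow_le_rpow_of_exponent_le h.le (by linarith : (1 : ℝ) ≤ 1 + β)
    linarith

/-! ### Fourier weights -/

section JapaneseWeight

variable {E : Type*} [NormedAddCommGroup E]

/-- The weight `(1 + |ξ|²)^(r/2)`. -/
def japaneseWeight (r : ℝ) (ξ : E) : ℝ := (1 + ‖ξ‖ ^ 2) ^ (r / 2)

theorem japaneseWeight_pos (r : ℝ) (ξ : E) : 0 < japaneseWeight r ξ := by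
  unfold japaneseWeight; positivity

theorem continuous_japaneseWeight (r : ℝ) : Continuous (japaneseWeight r : E → ℝ) := by
  unfold japaneseWeight
  exact Continuous.rpow_const (by fun_prop) fun x => Or.inl (by positivity)

theorem japaneseWeight_mono {r r' : ℝ} (h : r ≤ r') (ξ : E) :
    japaneseWeight r ξ ≤ japaneseWeight r' ξ :=
  Real.rpow_le_rpow_of_exponent_le (by nlinarith [sq_nonneg ‖ξ‖]) (by linarith)

theorem japaneseWeight_zero (ξ : E) : japaneseWeight 0 ξ = 1 := by simp [japaneseWeight]

theorem japaneseWeight_two (ξ : E) : japaneseWeight 2 ξ = 1 + ‖ξ‖ ^ 2 := by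
  simp [japaneseWeight]

theorem japaneseWeight_mul (r r' : ℝ) (ξ : E) :
    japaneseWeight r ξ * japaneseWeight r' ξ = japaneseWeight (r + r') ξ := by
  rw [japaneseWeight, japaneseWeight, ← Real.rpow_add (by positivity), japaneseWeight]
  ring_nf

theorem norm_rpow_le_japaneseWeight {r : ℝ} (hr : 0 ≤ r) (ξ : E) :
    ‖ξ‖ ^ r ≤ japaneseWeight r ξ := by
  have : ‖ξ‖ ^ r = (‖ξ‖ ^ 2) ^ (r / 2) := by
    rw [← Real.rpow_natCast, ← Real.rpow_mul (norm_nonneg _)]; ring_nf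
  rw [this]
  exact Real.rpow_le_rpow (by positivity) (by linarith) (by linarith)

end JapaneseWeight

theorem norm_fourierInvLinearPart_integrand {E : Type*} [NormedAddCommGroup E]
    [InnerProductSpace ℝ E] (f : E → ℂ) (x ξ : E) :
    ‖((2 * Real.pi * ⟪ξ, x⟫_ℝ : ℝ) : ℂ) * Complex.I * f ξ‖ ≤
      2 * Real.pi * ‖x‖ * (‖ξ‖ * ‖f ξ‖) := by
  rw [norm_mul, norm_mul, Complex.norm_I, Complex.norm_real, mul_one, Real.norm_eq_abs, abs_mul,
    abs_of_pos Real.two_pi_pos]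
  have := abs_real_inner_le_norm ξ x
  calc _ ≤ 2 * Real.pi * (‖ξ‖ * ‖x‖) * ‖f ξ‖ := by gcongr
    _ = _ := by ring

/-! ### Taylor expansion of inverse Fourier integrals -/

section FourierTaylor

variable {E : Type*} [NormedAddCommGroup E] [InnerProductSpace ℝ E] [FiniteDimensional ℝ E]
  [MeasurableSpace E] [BorelSpace E]

/-- The differential at the origin of the inverse Fourier transform of `f`. -/
def fourierInvLinearPart (f : E → ℂ) (x : E) : ℂ :=
  ∫ ξ, ((2 * Real.pi * ⟪ξ, x⟫_ℝ : ℝ) : ℂ) * Complex.I * f ξ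

theorem fourierInvLinearPart_smul (f : E → ℂ) (h : ℝ) (x : E) :
    fourierInvLinearPart f (h • x) = h * fourierInvLinearPart f x := by
  rw [fourierInvLinearPart, fourierInvLinearPart, ← integral_const_mul]
  congr with ξ
  rw [inner_smul_right]
  push_cast
  ring

theorem norm_fourierInv_le (f : E → ℂ) (x : E) : ‖𝓕⁻ f x‖ ≤ ∫ ξ, ‖f ξ‖ := by
  rw [Real.fourierInv_eq']
  refine (norm_integral_le_integral_norm _).trans_eq ?_
  congr with ξ
  simp [Complex.norm_exp_ofReal_mul_I, -Complex.ofReal_mul]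

theorem continuous_fourierInv {f : E → ℂ} (hf : Integrable f) : Continuous (𝓕⁻ f) :=
  VectorFourier.fourierIntegral_continuous Real.continuous_fourierChar
    (by exact (continuous_inner.neg : Continuous fun p : E × E => -⟪p.1, p.2⟫_ℝ)) hf

variable {f : E → ℂ} {β : ℝ}

theorem integrable_of_japaneseWeight {r r' : ℝ} (h : r' ≤ r) (hm : AEStronglyMeasurable f)
    (hf : Integrable fun ξ => japaneseWeight r ξ * ‖f ξ‖) :
    Integrable fun ξ => japaneseWeight r' ξ * ‖f ξ‖ := by
  refine hf.mono ((continuous_japaneseWeight r').aestronglyMeasurable.mul hm.norm) ?_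
  refine Eventually.of_forall fun ξ => ?_
  rw [norm_mul, norm_mul, Real.norm_of_nonneg (japaneseWeight_pos _ _).le,
    Real.norm_of_nonneg (japaneseWeight_pos _ _).le]
  gcongr
  exact japaneseWeight_mono h ξ

theorem integrable_of_japaneseWeight_nonneg {r : ℝ} (h : 0 ≤ r) (hm : AEStronglyMeasurable f)
    (hf : Integrable fun ξ => japaneseWeight r ξ * ‖f ξ‖) : Integrable f := by
  have := integrable_of_japaneseWeight h hm hf
  simp only [japaneseWeight_zero, one_mul] at this
  exact (integrable_norm_iff hm).1 this

theorem integrable_fourierInvLinearPart {r : ℝ} (hr : 1 ≤ r) (hm : AEStronglyMeasurable f)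
    (hf : Integrable fun ξ => japaneseWeight r ξ * ‖f ξ‖) (x : E) :
    Integrable fun ξ => ((2 * Real.pi * ⟪ξ, x⟫_ℝ : ℝ) : ℂ) * Complex.I * f ξ := by
  refine ((integrable_of_japaneseWeight hr hm hf).const_mul (2 * Real.pi * ‖x‖)).mono'
    (AEStronglyMeasurable.mul (Continuous.aestronglyMeasurable (by fun_prop)) hm)
    (Eventually.of_forall fun ξ => (norm_fourierInvLinearPart_integrand f x ξ).trans ?_)
  have := norm_rpow_le_japaneseWeight (zero_le_one) ξ
  rw [Real.rpow_one] at this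
  have := Real.pi_pos
  gcongr

theorem norm_fourierInvLinearPart_le {r : ℝ} (hr : 1 ≤ r)
    (hf : Integrable fun ξ => japaneseWeight r ξ * ‖f ξ‖) (x : E) :
    ‖fourierInvLinearPart f x‖ ≤
      2 * Real.pi * ‖x‖ * ∫ ξ, japaneseWeight r ξ * ‖f ξ‖ := by
  rw [fourierInvLinearPart, ← integral_const_mul]
  refine norm_integral_le_of_norm_le (hf.const_mul _)
    (Eventually.of_forall fun ξ => (norm_fourierInvLinearPart_integrand f x ξ).trans ?_)
  have := (norm_rpow_le_japaneseWeight (zero_le_one) ξ).trans (japaneseWeight_mono hr ξ)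
  rw [Real.rpow_one] at this
  have := Real.pi_pos
  gcongr

/-- First order Taylor expansion at the origin of an inverse Fourier transform, with a remainder
of Hölder type. -/
theorem norm_fourierInv_sub_le (hβ₀ : 0 ≤ β) (hβ₁ : β ≤ 1) (hm : AEStronglyMeasurable f)
    (hf : Integrable fun ξ => japaneseWeight (1 + β) ξ * ‖f ξ‖) (x : E) :
    ‖𝓕⁻ f x - 𝓕⁻ f 0 - fourierInvLinearPart f x‖ ≤
      3 * (2 * Real.pi) ^ (1 + β) * ‖x‖ ^ (1 + β) * ∫ ξ, japaneseWeight (1 + β) ξ * ‖f ξ‖ := by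
  have hfi : Integrable f := integrable_of_japaneseWeight_nonneg (by linarith) hm hf
  have hex : ∀ y : E, Integrable fun ξ => Complex.exp (↑(2 * Real.pi * ⟪ξ, y⟫_ℝ) * Complex.I) • f ξ := by
    intro y
    have hc : Continuous fun ξ : E => Complex.exp (↑(2 * Real.pi * ⟪ξ, y⟫_ℝ) * Complex.I) := by
      fun_prop
    refine hfi.norm.mono' (hc.aestronglyMeasurable.smul hm) (Eventually.of_forall fun ξ => ?_)
    rw [norm_smul, Complex.norm_exp_ofReal_mul_I, one_mul]
  rw [Real.fourierInv_eq', Real.fourierInv_eq', fourierInvLinearPart,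
    ← integral_sub (hex x) (hex 0), ← integral_sub (by exact (hex x).sub (hex 0))
      (integrable_fourierInvLinearPart (by linarith) hm hf x), ← integral_const_mul]
  refine norm_integral_le_of_norm_le (hf.const_mul _) (Eventually.of_forall fun ξ => ?_)
  have e : Complex.exp (↑(2 * Real.pi * ⟪ξ, x⟫_ℝ) * Complex.I) • f ξ -
      Complex.exp (↑(2 * Real.pi * ⟪ξ, (0 : E)⟫_ℝ) * Complex.I) • f ξ -
      ((2 * Real.pi * ⟪ξ, x⟫_ℝ : ℝ) : ℂ) * Complex.I * f ξ =
      (Complex.exp (↑(2 * Real.pi * ⟪ξ, x⟫_ℝ) * Complex.I) - 1 -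
        ((2 * Real.pi * ⟪ξ, x⟫_ℝ : ℝ) : ℂ) * Complex.I) * f ξ := by
    simp only [inner_zero_right, mul_zero, Complex.ofReal_zero, zero_mul, Complex.exp_zero,
      smul_eq_mul]
    ring
  rw [e, norm_mul]
  have h1 := norm_exp_mul_I_sub_one_sub_le hβ₀ hβ₁ (2 * Real.pi * ⟪ξ, x⟫_ℝ)
  have h2 : |2 * Real.pi * ⟪ξ, x⟫_ℝ| ^ (1 + β) ≤
      (2 * Real.pi) ^ (1 + β) * ‖x‖ ^ (1 + β) * japaneseWeight (1 + β) ξ := by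
    have h3 : |2 * Real.pi * ⟪ξ, x⟫_ℝ| ≤ 2 * Real.pi * ‖x‖ * ‖ξ‖ := by
      rw [abs_mul, abs_of_pos Real.two_pi_pos]
      have := abs_real_inner_le_norm ξ x
      have := Real.pi_pos
      calc _ ≤ 2 * Real.pi * (‖ξ‖ * ‖x‖) := by gcongr
        _ = _ := by ring
    have hpi := Real.two_pi_pos
    calc _ ≤ (2 * Real.pi * ‖x‖ * ‖ξ‖) ^ (1 + β) :=
          Real.rpow_le_rpow (abs_nonneg _) h3 (by linarith)
      _ = (2 * Real.pi) ^ (1 + β) * ‖x‖ ^ (1 + β) * ‖ξ‖ ^ (1 + β) := by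
          rw [Real.mul_rpow (by positivity) (norm_nonneg _),
            Real.mul_rpow hpi.le (norm_nonneg _)]
      _ ≤ _ := by
          gcongr
          exact norm_rpow_le_japaneseWeight (by linarith) ξ
  calc _ ≤ 3 * ((2 * Real.pi) ^ (1 + β) * ‖x‖ ^ (1 + β) * japaneseWeight (1 + β) ξ) * ‖f ξ‖ := by
        gcongr; exact h1.trans (by gcongr)
    _ = _ := by ring

/-- An `L²` function with integrable Fourier transform agrees with the inverse Fourier integral. -/
theorem fourierInv_ae_eq (F : Lp ℂ 2 (volume : Measure E)) (hF : Integrable F) :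
    (𝓕⁻ F : Lp ℂ 2 (volume : Measure E)) =ᵐ[volume] 𝓕⁻ (F : E → ℂ) := by
  refine ae_eq_of_integral_contDiff_smul_eq
    ((Lp.memLp _).locallyIntegrable (by norm_num))
    (continuous_fourierInv hF).locallyIntegrable fun g hg hgc => ?_
  have hg₁ : HasCompactSupport (Complex.ofRealCLM ∘ g) := hgc.comp_left rfl
  have hg₂ : ContDiff ℝ ∞ (Complex.ofRealCLM ∘ g) := by fun_prop
  set ψ := hg₁.toSchwartzMap hg₂ with hψ
  have h1 : ∫ x, g x • (𝓕⁻ F : Lp ℂ 2 (volume : Measure E)) x =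
      Lp.toTemperedDistribution (𝓕⁻ F) ψ := by
    simp [hψ]
  rw [h1, ← Lp.fourierInv_toTemperedDistribution_eq, TemperedDistribution.fourierInv_apply,
    Lp.toTemperedDistribution_apply]
  -- Fubini moves the inverse Fourier transform from the test function onto `F`; this is where
  -- integrability of `F` is needed.
  have h2 := VectorFourier.integral_fourierIntegral_smul_eq_flip (μ := (volume : Measure E))
    (ν := (volume : Measure E))
    (L := -innerₗ E) (f := ψ) (g := (F : E → ℂ)) Real.continuous_fourierChar
    (by exact (continuous_inner.neg : Continuous fun p : E × E => -⟪p.1, p.2⟫_ℝ))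
    ψ.integrable hF
  have hflip : (-innerₗ E : E →ₗ[ℝ] E →ₗ[ℝ] ℝ).flip = -innerₗ E := by
    ext x y
    simp [real_inner_comm]
  rw [hflip] at h2
  have h3 : ∀ x, (𝓕⁻ ψ : 𝓢(E, ℂ)) x =
      VectorFourier.fourierIntegral Real.fourierChar volume (-innerₗ E) ψ x := fun x => by
    rw [SchwartzMap.fourierInv_coe]; rfl
  simp only [h3]
  rw [h2]
  refine integral_congr_ae (Eventually.of_forall fun x => ?_)
  simp only [hψ, HasCompactSupport.toSchwartzMap_toFun, Function.comp_apply,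
    Complex.ofRealCLM_apply, Complex.coe_smul]
  rfl

end FourierTaylor

/-! ### From weak derivatives to the energy method -/

section Evolution

/-- A curve in `L²` whose derivative, in the sense of tempered distributions, is a continuous
curve in `L²` is differentiable in `L²`. -/
theorem hasDerivAt_of_tempered {N : ℕ} {T : ℝ} {W V : ℝ → L2 N}
    (hV : ContinuousOn V (Set.Ioo 0 T))
    (h : ∀ t ∈ Set.Ioo 0 T, ∀ ψ : 𝓢(EuclideanSpace ℝ (Fin N), ℂ),
      HasDerivAt (fun τ => Lp.toTemperedDistribution (W τ) ψ)
        (Lp.toTemperedDistribution (V t) ψ) t)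
    {t₀ : ℝ} (ht₀ : t₀ ∈ Set.Ioo 0 T) : HasDerivAt W (V t₀) t₀ := by
  -- The Bochner primitive of `V`. Against each test function `W - F` has zero derivative, so `W -
  -- F` is constant because `L²` embeds in tempered distributions.
  set F : ℝ → L2 N := fun t => ∫ τ in t₀..t, V τ with hF
  have hFd : ∀ t ∈ Set.Ioo 0 T, HasDerivAt F (V t) t := by
    intro t ht
    have hsub : Set.uIcc t₀ t ⊆ Set.Ioo 0 T := Set.OrdConnected.uIcc_subset inferInstance ht₀ ht
    refine intervalIntegral.integral_hasDerivAt_right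
      (hV.mono hsub).intervalIntegrable ?_ (hV.continuousAt (Ioo_mem_nhds ht.1 ht.2))
    exact hV.stronglyMeasurableAtFilter isOpen_Ioo t ht
  have hF0 : F t₀ = 0 := by simp [hF]
  have hconst : ∀ t ∈ Set.Ioo 0 T, W t = F t + W t₀ := by
    intro t ht
    apply SobolevSpace.toTemperedDistribution_injective
    ext ψ
    have key : ∀ τ ∈ Set.Ioo 0 T, HasDerivAt (fun τ => Lp.toTemperedDistribution (W τ) ψ -
        Lp.toTemperedDistribution (F τ) ψ) 0 τ := by
      intro τ hτ
      have h1 : HasDerivAt (fun τ => Lp.toTemperedDistribution (F τ) ψ)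
          (Lp.toTemperedDistribution (V τ) ψ) τ := by
        let L : L2 N →L[ℂ] ℂ :=
          (PointwiseConvergenceCLM.evalCLM (RingHom.id ℂ) (E := 𝓢(EuclideanSpace ℝ (Fin N), ℂ))
            ℂ ψ).comp (Lp.toTemperedDistributionCLM ℂ volume 2)
        exact (L.restrictScalars ℝ).hasFDerivAt.comp_hasDerivAt τ (hFd τ hτ)
      simpa only [sub_self] using! (h τ hτ ψ).sub h1
    have h2 := (convex_Ioo 0 T).is_const_of_fderivWithin_eq_zero (𝕜 := ℝ)
      (f := fun τ => Lp.toTemperedDistribution (W τ) ψ - Lp.toTemperedDistribution (F τ) ψ)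
      (fun τ hτ => (key τ hτ).differentiableAt.differentiableWithinAt)
      (fun τ hτ => by
        rw [fderivWithin_of_isOpen isOpen_Ioo hτ]
        ext
        simp only [fderiv_eq_smul_deriv, (key τ hτ).deriv, smul_zero]; rfl) ht ht₀
    simp only [hF0, ← Lp.toTemperedDistributionCLM_apply, map_zero, map_add] at h2 ⊢
    have h2' : (Lp.toTemperedDistributionCLM ℂ volume 2 (W t)) ψ
      - (Lp.toTemperedDistributionCLM ℂ volume 2 (F t)) ψ
      = (Lp.toTemperedDistributionCLM ℂ volume 2 (W t₀)) ψ := by simpa using h2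
    change _ = (Lp.toTemperedDistributionCLM ℂ volume 2 (F t)) ψ +
      (Lp.toTemperedDistributionCLM ℂ volume 2 (W t₀)) ψ
    rw [← h2']; ring
  refine ((hFd t₀ ht₀).add_const (W t₀)).congr_of_eventuallyEq ?_
  filter_upwards [Ioo_mem_nhds ht₀.1 ht₀.2] with t ht using hconst t ht

/-- The energy inequality. -/
theorem eq_zero_of_re_inner_le {X : Type*} [NormedAddCommGroup X] [InnerProductSpace ℂ X]
    {T K : ℝ} {W V : ℝ → X} (hW : ContinuousOn W (Set.Icc 0 T))
    (hd : ∀ t ∈ Set.Ioo 0 T, HasDerivAt W (V t) t)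
    (hK : ∀ t ∈ Set.Ioo 0 T, (⟪W t, V t⟫_ℂ).re ≤ K * ‖W t‖ ^ 2) (h0 : W 0 = 0) :
    ∀ t ∈ Set.Icc 0 T, W t = 0 := by
  intro t ht
  let _ : InnerProductSpace ℝ X := InnerProductSpace.rclikeToReal ℂ X
  -- The Grönwall factor turns the differential inequality for `‖W‖²` into monotonicity.
  set e : ℝ → ℝ := fun t => Real.exp (-(2 * K) * t) * ‖W t‖ ^ 2 with he
  have hde : ∀ t ∈ Set.Ioo 0 T, HasDerivAt e
      (Real.exp (-(2 * K) * t) * (2 * (⟪W t, V t⟫_ℂ).re - 2 * K * ‖W t‖ ^ 2)) t := by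
    intro t ht
    have h1 : HasDerivAt (fun t => ‖W t‖ ^ 2) (2 * (⟪W t, V t⟫_ℂ).re) t := (hd t ht).norm_sq
    have h2 : HasDerivAt (fun t => Real.exp (-(2 * K) * t))
        (Real.exp (-(2 * K) * t) * (-(2 * K))) t := by
      simpa using ((hasDerivAt_id t).const_mul (-(2 * K))).exp
    refine (h2.mul h1).congr_deriv ?_
    ring
  have hanti : AntitoneOn e (Set.Icc 0 T) := by
    refine antitoneOn_of_deriv_nonpos (convex_Icc 0 T) ?_ ?_ ?_
    · exact ContinuousOn.mul (by fun_prop) (hW.norm.pow 2)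
    · rw [interior_Icc]
      exact fun t ht => (hde t ht).differentiableAt.differentiableWithinAt
    · rw [interior_Icc]
      intro t ht
      rw [(hde t ht).deriv]
      exact mul_nonpos_of_nonneg_of_nonpos (Real.exp_pos _).le (by linarith [hK t ht])
  have h1 : e t ≤ e 0 := hanti ⟨le_rfl, ht.1.trans ht.2⟩ ht ht.1
  have h2 : e 0 = 0 := by simp [he, h0]
  have h3 : ‖W t‖ ^ 2 ≤ 0 := by
    have := h1.trans_eq h2
    by_contra hcon
    exact absurd this (not_le.2 (mul_pos (Real.exp_pos _) (not_le.1 hcon)))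
  exact norm_eq_zero.1 (pow_eq_zero_iff two_ne_zero |>.1 (le_antisymm h3 (by positivity)))

end Evolution

/-! ### Bounded Fourier multipliers on `L²` -/

section Multiplier

variable {N : ℕ}

/-- Multiplication by a bounded function on `L²`. -/
def mulBounded {k : EuclideanSpace ℝ (Fin N) → ℂ} (hk : MemLp k ∞ volume) : L2 N →L[ℂ] L2 N :=
  (ContinuousLinearMap.lsmul ℂ ℂ).holderL volume ∞ 2 2 hk.toLp

theorem mulBounded_eq_smul {k : EuclideanSpace ℝ (Fin N) → ℂ} (hk : MemLp k ∞ volume) (f : L2 N) :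
    mulBounded hk f = (hk.toLp _ • f : L2 N) := rfl

theorem coeFn_mulBounded {k : EuclideanSpace ℝ (Fin N) → ℂ} (hk : MemLp k ∞ volume) (f : L2 N) :
    mulBounded hk f =ᵐ[volume] fun ξ => k ξ * f ξ := by
  rw [mulBounded_eq_smul]
  filter_upwards [Lp.coeFn_lpSMul (r := 2) (hk.toLp _) f, hk.coeFn_toLp] with ξ h1 h2
  rw [h1, Pi.smul_apply', h2, smul_eq_mul]

theorem toTemperedDistribution_mulBounded {k : EuclideanSpace ℝ (Fin N) → ℂ}
    (hk : MemLp k ∞ volume) (hk' : k.HasTemperateGrowth) (f : L2 N) :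
    Lp.toTemperedDistribution (mulBounded hk f) =
      smulLeftCLM ℂ k (Lp.toTemperedDistribution f) := by
  rw [mulBounded_eq_smul, Lp.toTemperedDistribution_smul_eq hk' hk]

theorem hasTemperateGrowth_japaneseWeight (r : ℝ) :
    (fun ξ : EuclideanSpace ℝ (Fin N) => (japaneseWeight r ξ : ℂ)).HasTemperateGrowth := by
  unfold japaneseWeight
  fun_prop

theorem memLp_top_japaneseWeight {r : ℝ} (hr : 0 ≤ r) :
    MemLp (fun ξ : EuclideanSpace ℝ (Fin N) => (japaneseWeight (-r) ξ : ℂ)) ∞ volume := by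
  refine memLp_top_of_bound
    (Complex.continuous_ofReal.comp (continuous_japaneseWeight _)).aestronglyMeasurable 1
    (Eventually.of_forall fun ξ => ?_)
  rw [Complex.norm_real, Real.norm_of_nonneg (japaneseWeight_pos _ _).le]
  exact (japaneseWeight_mono (neg_nonpos.2 hr) ξ).trans_eq (japaneseWeight_zero ξ)

theorem memLp_top_normSq_mul_japaneseWeight {r : ℝ} (hr : 2 ≤ r) :
    MemLp (fun ξ : EuclideanSpace ℝ (Fin N) =>
      ((‖ξ‖ ^ 2 : ℝ) : ℂ) * (japaneseWeight (-r) ξ : ℂ)) ∞ volume := by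
  refine memLp_top_of_bound (Continuous.aestronglyMeasurable ?_) 1
    (Eventually.of_forall fun ξ => ?_)
  · exact (by fun_prop : Continuous fun ξ : EuclideanSpace ℝ (Fin N) => ((‖ξ‖ ^ 2 : ℝ) : ℂ)).mul
      (Complex.continuous_ofReal.comp (continuous_japaneseWeight _))
  · rw [norm_mul, Complex.norm_real, Complex.norm_real,
      Real.norm_of_nonneg (japaneseWeight_pos _ _).le, Real.norm_of_nonneg (by positivity)]
    have h1 : ‖ξ‖ ^ 2 ≤ japaneseWeight 2 ξ := by rw [japaneseWeight_two]; linarith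
    calc _ ≤ japaneseWeight 2 ξ * japaneseWeight (-r) ξ := by
          gcongr; exact (japaneseWeight_pos _ _).le
      _ = japaneseWeight (2 + -r) ξ := japaneseWeight_mul _ _ _
      _ ≤ japaneseWeight 0 ξ := japaneseWeight_mono (by linarith) ξ
      _ = 1 := japaneseWeight_zero ξ

end Multiplier

/-! ### `Hˢ` on the Fourier side -/

namespace SobolevSpace

variable {N : ℕ} {s : ℝ}

/-- The `L²` function `(1 + |ξ|²)^(s/2) 𝓕 u`. -/
def besselHat : SobolevSpace N s →ₗᵢ[ℂ] L2 N where
  toLinearMap := (Lp.fourierTransformₗᵢ (EuclideanSpace ℝ (Fin N)) ℂ).toLinearMap ∘ₗ bessel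
  norm_map' u := ((Lp.fourierTransformₗᵢ (EuclideanSpace ℝ (Fin N)) ℂ).norm_map (bessel u)).trans
    (norm_def u).symm

/-- The Fourier transform of an element of `Hˢ`. -/
def hat (hs : 0 ≤ s) : SobolevSpace N s →L[ℂ] L2 N :=
  mulBounded (memLp_top_japaneseWeight hs) ∘L besselHat.toContinuousLinearMap

/-- The Fourier transform of the Laplacian of an element of `Hˢ`. -/
def lapHat (hs : 2 ≤ s) : SobolevSpace N s →L[ℂ] L2 N :=
  ((-(2 * Real.pi) ^ 2 : ℝ) : ℂ) •
    (mulBounded (memLp_top_normSq_mul_japaneseWeight hs) ∘L besselHat.toContinuousLinearMap)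

theorem fourier_toTemperedDistribution_toL2 (u : SobolevSpace N s) :
    𝓕 (Lp.toTemperedDistribution (toL2 u)) =
      smulLeftCLM ℂ (fun ξ => (japaneseWeight (-s) ξ : ℂ))
        (Lp.toTemperedDistribution (besselHat u)) := by
  have h := (besselPotential_neg_apply_eq_iff s _ _).2 (besselFun_spec u)
  rw [← h, fourier_besselPotential_eq_smulLeftCLM_fourier_apply,
    Lp.fourier_toTemperedDistribution_eq]
  rfl

theorem fourier_toL2 (hs : 0 ≤ s) (u : SobolevSpace N s) : 𝓕 (toL2 u) = hat hs u := by
  apply toTemperedDistribution_injective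
  dsimp only
  rw [← Lp.fourier_toTemperedDistribution_eq, fourier_toTemperedDistribution_toL2]
  exact (toTemperedDistribution_mulBounded _ (hasTemperateGrowth_japaneseWeight _) _).symm

theorem toL2_eq_fourierInv (hs : 0 ≤ s) (u : SobolevSpace N s) : toL2 u = 𝓕⁻ (hat hs u) := by
  rw [← fourier_toL2 hs, fourierInv_fourier_eq]

theorem continuous_toL2 (hs : 0 ≤ s) : Continuous (toL2 : SobolevSpace N s → L2 N) := by
  have : (toL2 : SobolevSpace N s → L2 N) = fun u => 𝓕⁻ (hat hs u) :=
    funext (toL2_eq_fourierInv hs)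
  rw [this]
  exact (Lp.fourierTransformₗᵢ (EuclideanSpace ℝ (Fin N)) ℂ).symm.continuous.comp (hat hs).continuous

/-- The Laplacian, from `Hˢ` to `L²`. -/
def lap (hs : 2 ≤ s) (u : SobolevSpace N s) : L2 N := 𝓕⁻ (lapHat hs u)

theorem continuous_lap (hs : 2 ≤ s) : Continuous (lap hs : SobolevSpace N s → L2 N) :=
  (Lp.fourierTransformₗᵢ (EuclideanSpace ℝ (Fin N)) ℂ).symm.continuous.comp (lapHat hs).continuous

theorem laplacian_toTemperedDistribution_toL2 (hs : 2 ≤ s) (u : SobolevSpace N s) :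
    Δ (Lp.toTemperedDistribution (toL2 u)) = Lp.toTemperedDistribution (lap hs u) := by
  have hg : (fun ξ : EuclideanSpace ℝ (Fin N) => ((‖ξ‖ ^ 2 : ℝ) : ℂ)).HasTemperateGrowth := by
    fun_prop
  rw [TemperedDistribution.laplacian_eq_fourierMultiplierCLM,
    TemperedDistribution.fourierMultiplierCLM_apply, fourier_toTemperedDistribution_toL2,
    smulLeftCLM_smulLeftCLM_apply (hasTemperateGrowth_japaneseWeight _) hg, lap,
    ← Lp.fourierInv_toTemperedDistribution_eq]
  have h1 : Lp.toTemperedDistribution (lapHat hs u) = ((-(2 * Real.pi) ^ 2 : ℝ) : ℂ) •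
      Lp.toTemperedDistribution
        (mulBounded (memLp_top_normSq_mul_japaneseWeight hs) (besselHat u)) :=
    (Lp.toTemperedDistributionCLM ℂ volume 2).map_smul _ _
  rw [h1, toTemperedDistribution_mulBounded _ (hg.mul (hasTemperateGrowth_japaneseWeight _)),
    FourierTransform.fourierInv_smul, Complex.coe_smul]
  congr 4
  ext ξ
  simp [mul_comm]

theorem coeFn_hat (hs : 0 ≤ s) (u : SobolevSpace N s) :
    hat hs u =ᵐ[volume] fun ξ => (japaneseWeight (-s) ξ : ℂ) * besselHat u ξ :=
  coeFn_mulBounded _ _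

theorem coeFn_lapHat (hs : 2 ≤ s) (u : SobolevSpace N s) :
    lapHat hs u =ᵐ[volume] fun ξ =>
      ((-(2 * Real.pi) ^ 2 * ‖ξ‖ ^ 2 : ℝ) : ℂ) * hat (by linarith : (0 : ℝ) ≤ s) u ξ := by
  filter_upwards [coeFn_mulBounded (memLp_top_normSq_mul_japaneseWeight hs) (besselHat u),
    Lp.coeFn_smul ((-(2 * Real.pi) ^ 2 : ℝ) : ℂ)
      (mulBounded (memLp_top_normSq_mul_japaneseWeight hs) (besselHat u)),
    coeFn_hat (by linarith : (0 : ℝ) ≤ s) u] with ξ h1 h2 h3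
  change ((((-(2 * Real.pi) ^ 2 : ℝ) : ℂ) •
      mulBounded (memLp_top_normSq_mul_japaneseWeight hs) (besselHat u) : L2 N) : _ → ℂ) ξ = _
  rw [h2, Pi.smul_apply, h1, h3, smul_eq_mul]
  push_cast
  ring

/-- Weighted integrability of the Fourier transform of an element of `Hˢ`. -/
theorem exists_integral_hat_le (hs₀ : 0 ≤ s) {r : ℝ} (hr : r + N / 2 < s) :
    ∃ C : ℝ, 0 ≤ C ∧ ∀ u : SobolevSpace N s,
      (Integrable fun ξ => japaneseWeight r ξ * ‖hat hs₀ u ξ‖) ∧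
        ∫ ξ, japaneseWeight r ξ * ‖hat hs₀ u ξ‖ ≤ C * ‖u‖ := by
  -- Cauchy–Schwarz: the weight of order `r - s` is square integrable because `2(s - r) > N`, and
  -- its `L²` norm is the constant; the other factor is `besselHat u`, of norm `‖u‖`.
  have hm : MemLp (fun ξ : EuclideanSpace ℝ (Fin N) => (japaneseWeight (r - s) ξ : ℂ)) 2 volume := by
    refine (memLp_two_iff_integrable_sq_norm (by
      exact (Complex.continuous_ofReal.comp
        (continuous_japaneseWeight _)).aestronglyMeasurable)).2 ?_
    have := integrable_rpow_neg_one_add_norm_sq (E := EuclideanSpace ℝ (Fin N)) (μ := volume)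
      (r := 2 * (s - r)) (by rw [finrank_euclideanSpace_fin]; linarith)
    refine this.congr (Eventually.of_forall fun ξ => ?_)
    dsimp only
    rw [Complex.norm_real, Real.norm_of_nonneg (japaneseWeight_pos _ _).le, japaneseWeight,
      ← Real.rpow_mul_natCast (by positivity)]
    congr 1
    push_cast
    ring
  refine ⟨‖hm.toLp _‖, norm_nonneg _, fun u => ?_⟩
  set p : Lp ℂ 1 (volume : Measure (EuclideanSpace ℝ (Fin N))) :=
    hm.toLp _ • (besselHat u : L2 N) with hp
  have hpe : (fun ξ => ‖p ξ‖) =ᵐ[volume] fun ξ => japaneseWeight r ξ * ‖hat hs₀ u ξ‖ := by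
    filter_upwards [Lp.coeFn_lpSMul (r := 1) (hm.toLp _) (besselHat u : L2 N), hm.coeFn_toLp,
      coeFn_hat hs₀ u] with ξ h1 h2 h3
    rw [hp, h1, h3, Pi.smul_apply', h2, norm_smul, norm_mul, Complex.norm_real, Complex.norm_real,
      Real.norm_of_nonneg (japaneseWeight_pos _ _).le,
      Real.norm_of_nonneg (japaneseWeight_pos _ _).le, ← mul_assoc, japaneseWeight_mul,
      ← sub_eq_add_neg]
  refine ⟨(L1.integrable_coeFn p).norm.congr hpe, ?_⟩
  rw [← integral_congr_ae hpe, ← L1.norm_eq_integral_norm]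
  refine (Lp.norm_smul_le _ _).trans_eq ?_
  rw [LinearIsometry.norm_map]

/-- The symbol of the Laplacian is bounded by `(2π)²(1 + |ξ|²)`, so it costs exactly two orders of
weight. -/
theorem integrable_lapHat_and_le (hs : 2 ≤ s) {r : ℝ} (u : SobolevSpace N s)
    (h : Integrable fun ξ => japaneseWeight (r + 2) ξ * ‖hat (by linarith : (0 : ℝ) ≤ s) u ξ‖) :
    (Integrable fun ξ => japaneseWeight r ξ * ‖lapHat hs u ξ‖) ∧
      ∫ ξ, japaneseWeight r ξ * ‖lapHat hs u ξ‖ ≤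
        (2 * Real.pi) ^ 2 *
          ∫ ξ, japaneseWeight (r + 2) ξ * ‖hat (by linarith : (0 : ℝ) ≤ s) u ξ‖ := by
  have hle : ∀ᵐ ξ, ‖japaneseWeight r ξ * ‖lapHat hs u ξ‖‖ ≤ (2 * Real.pi) ^ 2 *
      (japaneseWeight (r + 2) ξ * ‖hat (by linarith : (0 : ℝ) ≤ s) u ξ‖) := by
    filter_upwards [coeFn_lapHat hs u] with ξ h1
    have h0 := (japaneseWeight_pos r ξ).le
    rw [norm_mul, norm_norm, Real.norm_of_nonneg h0, h1,
      norm_mul, Complex.norm_real, ← japaneseWeight_mul, japaneseWeight_two, norm_mul, norm_neg,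
      Real.norm_of_nonneg (by positivity), Real.norm_of_nonneg (by positivity)]
    have h2 : ‖ξ‖ ^ 2 ≤ 1 + ‖ξ‖ ^ 2 := by linarith
    calc _ ≤ japaneseWeight r ξ * ((2 * Real.pi) ^ 2 * (1 + ‖ξ‖ ^ 2) *
          ‖hat (by linarith : (0 : ℝ) ≤ s) u ξ‖) := by gcongr
      _ = _ := by ring
  have hint : Integrable fun ξ => japaneseWeight r ξ * ‖lapHat hs u ξ‖ :=
    (h.const_mul _).mono' ((continuous_japaneseWeight r).aestronglyMeasurable.mul
      (Lp.aestronglyMeasurable _).norm) hle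
  refine ⟨hint, ?_⟩
  rw [← integral_const_mul]
  refine integral_mono_ae hint (h.const_mul _) ?_
  filter_upwards [hle] with ξ h1 using (le_abs_self _).trans h1

end SobolevSpace

/-! ### Reflection and the Fourier transform -/

section Reflection

variable {N : ℕ}

/-- The reflection `f ↦ f(-·)` on `L²`. -/
def reflect : L2 N →ₗᵢ[ℂ] L2 N :=
  Lp.compMeasurePreservingₗᵢ ℂ (fun x => -x) (Measure.measurePreserving_neg volume)

theorem coeFn_reflect (f : L2 N) : reflect f =ᵐ[volume] fun x => f (-x) :=
  Lp.coeFn_compMeasurePreserving f (Measure.measurePreserving_neg volume)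

/-- The reflection of a Schwartz function. -/
def reflectSchwartz (ψ : 𝓢(EuclideanSpace ℝ (Fin N), ℂ)) : 𝓢(EuclideanSpace ℝ (Fin N), ℂ) :=
  SchwartzMap.compCLMOfContinuousLinearEquiv ℂ (ContinuousLinearEquiv.neg ℝ) ψ

theorem reflectSchwartz_apply (ψ : 𝓢(EuclideanSpace ℝ (Fin N), ℂ)) (x : EuclideanSpace ℝ (Fin N)) :
    reflectSchwartz ψ x = ψ (-x) := by
  simp [reflectSchwartz]

theorem toTemperedDistribution_reflect (f : L2 N) (ψ : 𝓢(EuclideanSpace ℝ (Fin N), ℂ)) :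
    Lp.toTemperedDistribution (reflect f) ψ =
      Lp.toTemperedDistribution f (reflectSchwartz ψ) := by
  rw [Lp.toTemperedDistribution_apply, Lp.toTemperedDistribution_apply,
    ← integral_neg_eq_self]
  have h : ∀ᵐ x, reflect f (-x) = f x := by
    have := (Measure.measurePreserving_neg volume).quasiMeasurePreserving.ae (coeFn_reflect f)
    filter_upwards [this] with x hx
    rw [hx, neg_neg]
  refine integral_congr_ae ?_
  filter_upwards [h] with x hx
  rw [hx, reflectSchwartz_apply]

theorem fourier_reflectSchwartz (ψ : 𝓢(EuclideanSpace ℝ (Fin N), ℂ)) :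
    𝓕 (reflectSchwartz ψ) = reflectSchwartz (𝓕 ψ) := by
  ext ξ
  rw [reflectSchwartz_apply, SchwartzMap.fourier_coe, SchwartzMap.fourier_coe]
  have : (reflectSchwartz ψ : EuclideanSpace ℝ (Fin N) → ℂ) =
      ψ ∘ LinearIsometryEquiv.neg ℝ := by
    ext x; rw [reflectSchwartz_apply]; rfl
  rw [this]
  exact Real.fourier_comp_linearIsometry _ _ _

/-- By duality the identity reduces to Schwartz functions, where the Fourier integral commutes with
the isometry `x ↦ -x`. -/
theorem fourier_reflect (f : L2 N) : (𝓕 (reflect f) : L2 N) = reflect (𝓕 f) := by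
  apply SobolevSpace.toTemperedDistribution_injective
  ext ψ
  dsimp only
  rw [← Lp.fourier_toTemperedDistribution_eq, TemperedDistribution.fourier_apply,
    toTemperedDistribution_reflect, toTemperedDistribution_reflect, ← fourier_reflectSchwartz,
    ← TemperedDistribution.fourier_apply, Lp.fourier_toTemperedDistribution_eq]

end Reflection

/-! ### Sobolev embedding and dissipativity -/

namespace SobolevSpace

variable {N : ℕ} {s : ℝ}

theorem toL2_ae_eq_fourierInv (hs₀ : 0 ≤ s) (hs : (N : ℝ) / 2 < s) (u : SobolevSpace N s) :
    toL2 u =ᵐ[volume] 𝓕⁻ (hat hs₀ u : EuclideanSpace ℝ (Fin N) → ℂ) := by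
  obtain ⟨C, -, hC⟩ := exists_integral_hat_le (N := N) hs₀ (r := 0) (by linarith)
  rw [toL2_eq_fourierInv hs₀]
  exact fourierInv_ae_eq _
    (integrable_of_japaneseWeight_nonneg le_rfl (Lp.aestronglyMeasurable _) (hC u).1)

/-- The Sobolev embedding of `Hˢ` in `L^∞`. -/
theorem exists_ae_norm_toL2_le (hs₀ : 0 ≤ s) (hs : (N : ℝ) / 2 < s) :
    ∃ C : ℝ, 0 ≤ C ∧ ∀ u : SobolevSpace N s, ∀ᵐ x, ‖toL2 u x‖ ≤ C * ‖u‖ := by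
  obtain ⟨C, hC0, hC⟩ := exists_integral_hat_le (N := N) hs₀ (r := 0) (by linarith)
  refine ⟨C, hC0, fun u => ?_⟩
  filter_upwards [toL2_ae_eq_fourierInv hs₀ hs u] with x hx
  rw [hx]
  refine (norm_fourierInv_le _ _).trans ?_
  simpa [japaneseWeight_zero] using (hC u).2

/-- The dissipativity of the Laplacian on even parts. -/
theorem inner_reflect_lap (hs : 2 ≤ s) (u : SobolevSpace N s) :
    ∃ r : ℝ, r ≤ 0 ∧
      ⟪toL2 u + reflect (toL2 u), lap hs u + reflect (lap hs u)⟫_ℂ = (r : ℂ) := by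
  have hs₀ : 0 ≤ s := by linarith
  set w : L2 N := hat hs₀ u + reflect (hat hs₀ u) with hw
  set l : L2 N := lapHat hs u + reflect (lapHat hs u) with hl
  have h1 : 𝓕 (toL2 u + reflect (toL2 u)) = w := by
    rw [FourierAdd.fourier_add, fourier_reflect, fourier_toL2 hs₀]
  have h2 : 𝓕 (lap hs u + reflect (lap hs u)) = l := by
    rw [FourierAdd.fourier_add, fourier_reflect, lap, fourier_fourierInv_eq]
  have hlw : l =ᵐ[volume] fun ξ => ((-(2 * Real.pi) ^ 2 * ‖ξ‖ ^ 2 : ℝ) : ℂ) * w ξ := by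
    have hn := (Measure.measurePreserving_neg
      (volume : Measure (EuclideanSpace ℝ (Fin N)))).quasiMeasurePreserving.ae (coeFn_lapHat hs u)
    filter_upwards [hn, coeFn_lapHat hs u, coeFn_reflect (hat hs₀ u),
      coeFn_reflect (lapHat hs u), Lp.coeFn_add (hat hs₀ u) (reflect (hat hs₀ u)),
      Lp.coeFn_add (lapHat hs u) (reflect (lapHat hs u))] with ξ h3 h4 h5 h6 h7 h8
    rw [hl, h8, hw, h7, Pi.add_apply, Pi.add_apply, h6, h5, h4, h3, norm_neg]
    ring
  -- By Plancherel the pairing is the integral of the real nonpositive symbol against `|w|²`. Being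
  -- real matters: multiplying by `e^{iθ}` then changes its real part only by the factor `cos θ`.
  refine ⟨∫ ξ, -(2 * Real.pi) ^ 2 * ‖ξ‖ ^ 2 * ‖w ξ‖ ^ 2,
    integral_nonpos fun ξ => ?_, ?_⟩
  · have : 0 ≤ (2 * Real.pi) ^ 2 * ‖ξ‖ ^ 2 * ‖w ξ‖ ^ 2 := by positivity
    simp only [Pi.zero_apply]
    linarith
  · rw [← Lp.inner_fourier_eq, h1, h2, L2.inner_def, ← integral_complex_ofReal]
    refine integral_congr_ae ?_
    filter_upwards [hlw] with ξ h
    rw [h, ← smul_eq_mul, inner_smul_right, inner_self_eq_norm_sq_to_K]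
    push_cast
    rfl

end SobolevSpace

/-! ### The nonlinearity as an operator on `L²` -/

section Nonlinearity

variable {N : ℕ} {α M : ℝ}

theorem memLp_powerNonlinearity (hα : 0 < α) {f : L2 N} (hf : ∀ᵐ x, ‖f x‖ ≤ M) :
    MemLp (fun x => powerNonlinearity α (f x)) 2 volume := by
  refine (Lp.memLp f).of_le_mul (c := M ^ α) ((continuous_powerNonlinearity
    hα.le).comp_aestronglyMeasurable (Lp.aestronglyMeasurable f)) ?_
  filter_upwards [hf] with x hx
  rw [norm_powerNonlinearity]
  gcongr

open Classical in
/-- The Nemytskii operator of the power nonlinearity on `L²`, extended by `0`. -/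
def nemytskii (α : ℝ) (f : L2 N) : L2 N :=
  if h : MemLp (fun x => powerNonlinearity α (f x)) 2 volume then h.toLp else 0

theorem coeFn_nemytskii (hα : 0 < α) {f : L2 N} (hf : ∀ᵐ x, ‖f x‖ ≤ M) :
    nemytskii α f =ᵐ[volume] fun x => powerNonlinearity α (f x) := by
  rw [nemytskii, dif_pos (memLp_powerNonlinearity hα hf)]
  exact MemLp.coeFn_toLp _

theorem norm_nemytskii_sub_le (hα : 0 < α) (hα₁ : α ≤ 1) {f g : L2 N}
    (hf : ∀ᵐ x, ‖f x‖ ≤ M) (hg : ∀ᵐ x, ‖g x‖ ≤ M) :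
    ‖nemytskii α f - nemytskii α g‖ ≤ 2 * M ^ α * ‖f - g‖ := by
  refine Lp.norm_le_mul_norm_of_ae_le_mul ?_
  filter_upwards [hf, hg, coeFn_nemytskii hα hf, coeFn_nemytskii hα hg, Lp.coeFn_sub f g,
    Lp.coeFn_sub (nemytskii α f) (nemytskii α g)] with x h1 h2 h3 h4 h5 h6
  rw [h6, h5, Pi.sub_apply, Pi.sub_apply, h3, h4]
  exact norm_powerNonlinearity_sub_le hα hα₁ h1 h2

theorem ae_norm_reflect_le {f : L2 N} (hf : ∀ᵐ x, ‖f x‖ ≤ M) : ∀ᵐ x, ‖reflect f x‖ ≤ M := by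
  have hn := (Measure.measurePreserving_neg
    (volume : Measure (EuclideanSpace ℝ (Fin N)))).quasiMeasurePreserving.ae hf
  filter_upwards [hn, coeFn_reflect f] with x h1 h2
  rwa [h2]

/-- Since `z ↦ |z|^α z` is odd, `nemytskii` sends `-reflect f` to `-reflect (nemytskii α f)`. The
bound is thus the Lipschitz estimate for the pair `f`, `-reflect f`. -/
theorem norm_nemytskii_add_reflect_le (hα : 0 < α) (hα₁ : α ≤ 1) {f : L2 N}
    (hf : ∀ᵐ x, ‖f x‖ ≤ M) :
    ‖nemytskii α f + reflect (nemytskii α f)‖ ≤ 2 * M ^ α * ‖f + reflect f‖ := by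
  have hr : ∀ᵐ x, ‖(-reflect f : L2 N) x‖ ≤ M := by
    filter_upwards [ae_norm_reflect_le hf, Lp.coeFn_neg (reflect f)] with x h1 h2
    rwa [h2, Pi.neg_apply, norm_neg]
  have h : nemytskii α (-reflect f) = -reflect (nemytskii α f) := by
    refine Lp.ext ?_
    have hn := (Measure.measurePreserving_neg
      (volume : Measure (EuclideanSpace ℝ (Fin N)))).quasiMeasurePreserving.ae
        (coeFn_nemytskii hα hf)
    filter_upwards [hn, coeFn_nemytskii hα hr, Lp.coeFn_neg (reflect f), coeFn_reflect f,
      Lp.coeFn_neg (reflect (nemytskii α f)), coeFn_reflect (nemytskii α f)]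
      with x h1 h2 h3 h4 h5 h6
    rw [h2, h3, h5, Pi.neg_apply, Pi.neg_apply, h6, h4, h1, powerNonlinearity_neg]
  have := norm_nemytskii_sub_le hα hα₁ hf hr
  rwa [h, sub_neg_eq_add, sub_neg_eq_add] at this

end Nonlinearity

/-! ### Persistence of oddness -/

section Parity

open SobolevSpace

variable {N : ℕ} {s α θ T : ℝ} {lam : ℂ} {φ : EuclideanSpace ℝ (Fin N) → ℂ}
  {u : ℝ → SobolevSpace N s}

/-- The right-hand side of the equation, as an element of `L²`. -/
def evolutionField (α θ : ℝ) (lam : ℂ) (hs₂ : 2 ≤ s) (v : SobolevSpace N s) : L2 N :=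
  Complex.exp (Complex.I * θ) • lap hs₂ v + lam • nemytskii α (toL2 v)

/-- A solution stays bounded on its interval of existence. -/
theorem IsSolution.exists_ae_norm_le (h : IsSolution N s α θ lam φ T u) (hs₀ : 0 ≤ s)
    (hs : (N : ℝ) / 2 < s) : ∃ M : ℝ, ∀ t ∈ Set.Icc 0 T, ∀ᵐ x, ‖toL2 (u t) x‖ ≤ M := by
  obtain ⟨C, hC0, hC⟩ := exists_ae_norm_toL2_le hs₀ hs
  obtain ⟨B, hB⟩ := isCompact_Icc.exists_bound_of_continuousOn h.continuousOn
  refine ⟨C * B, fun t ht => ?_⟩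
  filter_upwards [hC (u t)] with x hx
  exact hx.trans (mul_le_mul_of_nonneg_left (hB t ht) hC0)

theorem IsSolution.hasDerivAt_tempered (h : IsSolution N s α θ lam φ T u) (hα : 0 < α)
    (hs₂ : 2 ≤ s) (hs : (N : ℝ) / 2 < s) {t : ℝ} (ht : t ∈ Set.Ioo 0 T)
    (ψ : 𝓢(EuclideanSpace ℝ (Fin N), ℂ)) :
    HasDerivAt (fun τ => Lp.toTemperedDistribution (toL2 (u τ)) ψ)
      (Lp.toTemperedDistribution (evolutionField α θ lam hs₂ (u t)) ψ) t := by
  obtain ⟨M, hM⟩ := h.exists_ae_norm_le (by linarith) hs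
  refine (h.equation t ht ψ).congr_deriv ?_
  have e1 : Lp.toTemperedDistribution (evolutionField α θ lam hs₂ (u t)) ψ =
      Complex.exp (Complex.I * θ) * Lp.toTemperedDistribution (lap hs₂ (u t)) ψ +
        lam * Lp.toTemperedDistribution (nemytskii α (toL2 (u t))) ψ := by
    simp only [evolutionField, ← Lp.toTemperedDistributionCLM_apply, map_add, map_smul]
    rfl
  rw [e1, laplacian_toTemperedDistribution_toL2 hs₂,
    Lp.toTemperedDistribution_apply (nemytskii α (toL2 (u t)))]
  congr 2
  refine integral_congr_ae ?_
  filter_upwards [coeFn_nemytskii hα (hM t ⟨ht.1.le, ht.2.le⟩)] with x hx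
  rw [hx, smul_eq_mul, powerNonlinearity, mul_comm]

/-- Serves to upgrade the distributional time derivative to a derivative in `L²`, as the energy
method requires. -/
theorem IsSolution.continuousOn_evolutionField (h : IsSolution N s α θ lam φ T u) (hα : 0 < α)
    (hα₁ : α ≤ 1) (hs₂ : 2 ≤ s) (hs : (N : ℝ) / 2 < s) :
    ContinuousOn (fun t => evolutionField α θ lam hs₂ (u t)) (Set.Icc 0 T) := by
  have hs₀ : 0 ≤ s := by linarith
  obtain ⟨M, hM⟩ := h.exists_ae_norm_le hs₀ hs
  have hu2 : ContinuousOn (fun t => toL2 (u t)) (Set.Icc 0 T) :=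
    (continuous_toL2 hs₀).comp_continuousOn h.continuousOn
  have hnem : ContinuousOn (fun t => nemytskii α (toL2 (u t))) (Set.Icc 0 T) := by
    intro t ht
    rw [ContinuousWithinAt, tendsto_iff_norm_sub_tendsto_zero]
    have h1 : Tendsto (fun τ => 2 * M ^ α * ‖toL2 (u τ) - toL2 (u t)‖)
        (𝓝[Set.Icc 0 T] t) (𝓝 0) := by
      have := (tendsto_iff_norm_sub_tendsto_zero.1 (hu2 t ht)).const_mul (2 * M ^ α)
      simpa using this
    refine squeeze_zero' (Eventually.of_forall fun _ => norm_nonneg _) ?_ h1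
    filter_upwards [self_mem_nhdsWithin] with τ hτ
    exact norm_nemytskii_sub_le hα hα₁ (hM τ hτ) (hM t ht)
  have hlap : ContinuousOn (fun t => lap hs₂ (u t)) (Set.Icc 0 T) :=
    (continuous_lap hs₂).comp_continuousOn h.continuousOn
  unfold evolutionField
  have h1 := hlap.const_smul (Complex.exp (Complex.I * θ))
  have h2 := hnem.const_smul lam
  exact ContinuousOn.add h1 h2

/-- The linear part contributes `cos θ` times a nonpositive real, and the nonlinear part is
controlled by its Lipschitz bound. This is where `|θ| ≤ π/2` enters; the endpoints, where `cos θ =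
0`, are harmless. -/
theorem re_inner_evolutionField_le {M : ℝ} (hα : 0 < α) (hα₁ : α ≤ 1) (hθ : 0 ≤ Real.cos θ)
    (hs₂ : 2 ≤ s) {v : SobolevSpace N s} (hv : ∀ᵐ x, ‖toL2 v x‖ ≤ M) :
    (⟪toL2 v + reflect (toL2 v),
      evolutionField α θ lam hs₂ v + reflect (evolutionField α θ lam hs₂ v)⟫_ℂ).re ≤
      ‖lam‖ * (2 * M ^ α) * ‖toL2 v + reflect (toL2 v)‖ ^ 2 := by
  obtain ⟨r, hr, hr'⟩ := inner_reflect_lap hs₂ v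
  have e : evolutionField α θ lam hs₂ v + reflect (evolutionField α θ lam hs₂ v) =
      Complex.exp (Complex.I * θ) • (lap hs₂ v + reflect (lap hs₂ v)) +
        lam • (nemytskii α (toL2 v) + reflect (nemytskii α (toL2 v))) := by
    rw [evolutionField, map_add, map_smul, map_smul, smul_add, smul_add]
    exact add_add_add_comm _ _ _ _
  rw [e, inner_add_right, inner_smul_right, hr', Complex.add_re]
  have e1 : (Complex.exp (Complex.I * θ) * r).re ≤ 0 := by
    rw [mul_comm Complex.I, Complex.re_mul_ofReal, Complex.exp_ofReal_mul_I_re]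
    exact mul_nonpos_of_nonneg_of_nonpos hθ hr
  have e2 : (⟪toL2 v + reflect (toL2 v), lam • (nemytskii α (toL2 v) +
      reflect (nemytskii α (toL2 v)))⟫_ℂ).re ≤
      ‖lam‖ * (2 * M ^ α) * ‖toL2 v + reflect (toL2 v)‖ ^ 2 := by
    refine (Complex.re_le_norm _).trans ((norm_inner_le_norm _ _).trans ?_)
    rw [norm_smul]
    have := norm_nemytskii_add_reflect_le hα hα₁ hv
    calc _ ≤ ‖toL2 v + reflect (toL2 v)‖ *
          (‖lam‖ * (2 * M ^ α * ‖toL2 v + reflect (toL2 v)‖)) := by gcongr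
      _ = _ := by ring
  linarith

theorem add_reflect_eq_zero_of_odd {f : L2 N} (hf : f =ᵐ[volume] φ) (hφ : ∀ x, φ (-x) = -φ x) :
    f + reflect f = 0 := by
  refine Lp.ext ?_
  have hn := (Measure.measurePreserving_neg
    (volume : Measure (EuclideanSpace ℝ (Fin N)))).quasiMeasurePreserving.ae hf
  filter_upwards [hn, hf, coeFn_reflect f, Lp.coeFn_zero ℂ 2 volume,
    Lp.coeFn_add f (reflect f)] with x h1 h2 h3 h4 h5
  rw [h5, Pi.add_apply, h3, h4, h1, h2, hφ]
  simp

/-- The solutions with odd initial value are odd. -/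
theorem IsSolution.add_reflect_eq_zero (h : IsSolution N s α θ lam φ T u) (hα : 0 < α)
    (hα₁ : α ≤ 1) (hθ : 0 ≤ Real.cos θ) (hs₂ : 2 ≤ s) (hs : (N : ℝ) / 2 < s)
    (hφ : ∀ x, φ (-x) = -φ x) :
    ∀ t ∈ Set.Icc 0 T, toL2 (u t) + reflect (toL2 (u t)) = 0 := by
  obtain ⟨M, hM⟩ := h.exists_ae_norm_le (by linarith) hs
  have hu2 : ContinuousOn (fun t => toL2 (u t)) (Set.Icc 0 T) :=
    (continuous_toL2 (by linarith)).comp_continuousOn h.continuousOn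
  have hAc := h.continuousOn_evolutionField hα hα₁ hs₂ hs
  have hW : ∀ t ∈ Set.Ioo 0 T, HasDerivAt (fun t => toL2 (u t))
      (evolutionField α θ lam hs₂ (u t)) t := fun t ht =>
    hasDerivAt_of_tempered (hAc.mono Set.Ioo_subset_Icc_self)
      (fun τ hτ ψ => h.hasDerivAt_tempered hα hs₂ hs hτ ψ) ht
  have hWr : ∀ t ∈ Set.Ioo 0 T, HasDerivAt (fun t => toL2 (u t) + reflect (toL2 (u t)))
      (evolutionField α θ lam hs₂ (u t) + reflect (evolutionField α θ lam hs₂ (u t))) t :=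
    fun t ht => (hW t ht).add (((reflect (N := N)).toContinuousLinearMap.restrictScalars
      ℝ).hasFDerivAt.comp_hasDerivAt t (hW t ht))
  exact eq_zero_of_re_inner_le (hu2.add (reflect.continuous.comp_continuousOn hu2)) hWr
    (fun t ht => re_inner_evolutionField_le hα hα₁ hθ hs₂ (hM t ⟨ht.1.le, ht.2.le⟩))
    (add_reflect_eq_zero_of_odd h.initial hφ)

end Parity

/-! ### Measuring regularity at the origin by rescaled test functions -/

section Scaling

variable {N : ℕ} {χ : EuclideanSpace ℝ (Fin N) → ℝ} {α β h : ℝ}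

/-- The pairing of `f` with the test function `h⁻ᴺ χ(·/h) - 2 (h/2)⁻ᴺ χ(2 ·/h)`. -/
def scalePairing (χ : EuclideanSpace ℝ (Fin N) → ℝ) (h : ℝ) (f : EuclideanSpace ℝ (Fin N) → ℂ) :
    ℂ :=
  ∫ y, (χ y : ℂ) * (f (h • y) - 2 * f ((h / 2) • y))

theorem integrable_mul_of_hasCompactSupport (hχ : Continuous χ) (hχc : HasCompactSupport χ)
    {f : EuclideanSpace ℝ (Fin N) → ℂ} (hf : Continuous f) :
    Integrable fun y => (χ y : ℂ) * f y :=
  Continuous.integrable_of_hasCompactSupport (by fun_prop)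
    ((hχc.comp_left (g := ((↑) : ℝ → ℂ)) Complex.ofReal_zero).mul_right)

theorem exists_schwartz_integral_eq_dilate (hχ : ContDiff ℝ ∞ χ) (hχc : HasCompactSupport χ)
    (hh : 0 < h) : ∃ ψ : 𝓢(EuclideanSpace ℝ (Fin N), ℂ), HasCompactSupport ψ ∧
      ∀ f : EuclideanSpace ℝ (Fin N) → ℂ, ∫ x, ψ x * f x = ∫ y, (χ y : ℂ) * f (h • y) := by
  have hc : HasCompactSupport fun x : EuclideanSpace ℝ (Fin N) => ((χ (h⁻¹ • x) : ℝ) : ℂ) :=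
    (hχc.comp_smul (inv_ne_zero hh.ne')).comp_left (g := ((↑) : ℝ → ℂ)) Complex.ofReal_zero
  have hs : ContDiff ℝ ∞ fun x : EuclideanSpace ℝ (Fin N) => ((χ (h⁻¹ • x) : ℝ) : ℂ) :=
    Complex.ofRealCLM.contDiff.comp (hχ.comp (contDiff_const_smul _))
  refine ⟨((|(h ^ N)⁻¹| : ℝ) : ℂ) • hc.toSchwartzMap hs, ?_, fun f => ?_⟩
  · exact hc.smul_left (f := fun _ => ((|(h ^ N)⁻¹| : ℝ) : ℂ))
  · have := Measure.integral_comp_smul (volume : Measure (EuclideanSpace ℝ (Fin N)))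
      (fun x => ((χ (h⁻¹ • x) : ℝ) : ℂ) * f x) h
    simp only [smul_smul, inv_mul_cancel₀ hh.ne', one_smul, finrank_euclideanSpace_fin] at this
    rw [this, ← integral_smul]
    refine integral_congr_ae (Eventually.of_forall fun x => ?_)
    change ((|(h ^ N)⁻¹| : ℝ) : ℂ) • ((χ (h⁻¹ • x) : ℝ) : ℂ) * f x = _
    simp only [smul_eq_mul, Complex.real_smul]
    ring

/-- Makes `scalePairing` an admissible test in the weak form of the equation. -/
theorem exists_schwartz_integral_eq_scalePairing (hχ : ContDiff ℝ ∞ χ) (hχc : HasCompactSupport χ)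
    (hh : 0 < h) : ∃ ψ : 𝓢(EuclideanSpace ℝ (Fin N), ℂ),
      ∀ f : EuclideanSpace ℝ (Fin N) → ℂ, Continuous f →
        ∫ x, ψ x * f x = scalePairing χ h f := by
  obtain ⟨ψ₁, hc₁, h₁⟩ := exists_schwartz_integral_eq_dilate hχ hχc hh
  obtain ⟨ψ₂, hc₂, h₂⟩ := exists_schwartz_integral_eq_dilate hχ hχc (half_pos hh)
  refine ⟨ψ₁ - (2 : ℂ) • ψ₂, fun f hf => ?_⟩
  have i₁ : Integrable fun x => ψ₁ x * f x :=
    Continuous.integrable_of_hasCompactSupport (ψ₁.continuous.mul hf) hc₁.mul_right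
  have i₂ : Integrable fun x => ψ₂ x * f x :=
    Continuous.integrable_of_hasCompactSupport (ψ₂.continuous.mul hf) hc₂.mul_right
  have e : ∀ x, (ψ₁ - (2 : ℂ) • ψ₂) x * f x = ψ₁ x * f x - 2 * (ψ₂ x * f x) := fun x => by
    rw [sub_apply, smul_apply, smul_eq_mul]; ring
  simp only [e]
  rw [integral_sub i₁ (i₂.const_mul 2), integral_const_mul, h₁, h₂, scalePairing,
    ← integral_const_mul, ← integral_sub]
  · congr with y
    ring
  · exact integrable_mul_of_hasCompactSupport hχ.continuous hχc (by fun_prop)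
  · exact (integrable_mul_of_hasCompactSupport hχ.continuous hχc (by fun_prop)).const_mul 2

/-- The bounds are assumed only where `χ ≠ 0`, since the remainder of the nonlinearity is controlled
only on a ball. The factor 3 is `1 + 2`, the sum of the coefficients of the two dilates. -/
theorem norm_integral_scale_le (hχ : Continuous χ) (hχc : HasCompactSupport χ) (hβ : 0 ≤ β)
    (hh : 0 < h) {A : ℝ} (hA : 0 ≤ A) {r : EuclideanSpace ℝ (Fin N) → ℂ}
    (hr : ∀ y, χ y ≠ 0 → ‖r (h • y)‖ ≤ A * ‖h • y‖ ^ (1 + β))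
    (hr' : ∀ y, χ y ≠ 0 → ‖r ((h / 2) • y)‖ ≤ A * ‖(h / 2) • y‖ ^ (1 + β)) :
    ‖scalePairing χ h r‖ ≤ 3 * A * (∫ y, |χ y| * ‖y‖ ^ (1 + β)) * h ^ (1 + β) := by
  have hi : Integrable fun y => |χ y| * ‖y‖ ^ (1 + β) := by
    refine Continuous.integrable_of_hasCompactSupport ?_ ?_
    · exact hχ.abs.mul (continuous_norm.rpow_const fun _ => Or.inr (by linarith))
    · exact (hχc.comp_left (g := fun x : ℝ => |x|) abs_zero).mul_right
  have : 3 * A * (∫ y, |χ y| * ‖y‖ ^ (1 + β)) * h ^ (1 + β) =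
      ∫ y, 3 * A * h ^ (1 + β) * (|χ y| * ‖y‖ ^ (1 + β)) := by
    rw [integral_const_mul]; ring
  rw [this]
  refine norm_integral_le_of_norm_le (hi.const_mul _) (Eventually.of_forall fun y => ?_)
  by_cases hy : χ y = 0
  · simp [hy]
  have h1 := hr y hy
  have h2 := hr' y hy
  rw [norm_smul, Real.norm_of_nonneg hh.le, Real.mul_rpow hh.le (norm_nonneg _)] at h1
  rw [norm_smul, Real.norm_of_nonneg (half_pos hh).le,
    Real.mul_rpow (half_pos hh).le (norm_nonneg _)] at h2
  have h3 : (h / 2) ^ (1 + β) ≤ h ^ (1 + β) :=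
    Real.rpow_le_rpow (half_pos hh).le (by linarith) (by linarith)
  have h4 : ‖r ((h / 2) • y)‖ ≤ A * (h ^ (1 + β) * ‖y‖ ^ (1 + β)) := h2.trans (by gcongr)
  rw [norm_mul, Complex.norm_real, Real.norm_eq_abs]
  calc _ ≤ |χ y| * (A * (h ^ (1 + β) * ‖y‖ ^ (1 + β)) + 2 * (A * (h ^ (1 + β) * ‖y‖ ^ (1 + β)))) := by
        gcongr
        refine (norm_sub_le _ _).trans (add_le_add h1 ?_)
        rw [norm_mul, Complex.norm_ofNat]
        gcongr
    _ = _ := by ring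

/-- Constants vanish because `χ` is odd, linear maps because the two dilates cancel; only the Taylor
remainder is left. -/
theorem norm_scalePairing_le (hχ : Continuous χ) (hχc : HasCompactSupport χ)
    (hodd : ∀ x, χ (-x) = -χ x) (hβ : 0 ≤ β) (hh : 0 < h) {A : ℝ} (hA : 0 ≤ A)
    {f ℓ : EuclideanSpace ℝ (Fin N) → ℂ} (hf : Continuous f)
    (hℓ : ∀ (r : ℝ) x, ℓ (r • x) = r * ℓ x)
    (hfℓ : ∀ x, ‖f x - f 0 - ℓ x‖ ≤ A * ‖x‖ ^ (1 + β)) :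
    ‖scalePairing χ h f‖ ≤ 3 * A * (∫ y, |χ y| * ‖y‖ ^ (1 + β)) * h ^ (1 + β) := by
  have h0 : ∫ y, (χ y : ℂ) * f 0 = 0 := by
    have h1 := integral_neg_eq_self (fun y => (χ y : ℂ) * f 0) volume
    simp only [hodd, Complex.ofReal_neg, neg_mul, integral_neg] at h1
    exact self_eq_neg.1 h1.symm
  -- The constant `f 0` enters with coefficient `1 - 2 = -1`, so adding the null integral `∫ χ · f
  -- 0` removes it.
  have e : scalePairing χ h f = scalePairing χ h fun x => f x - f 0 - ℓ x := by
    rw [scalePairing, ← add_zero (∫ y, _), ← h0, ← integral_add]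
    · congr with y
      simp only [hℓ]
      push_cast
      ring
    · exact integrable_mul_of_hasCompactSupport hχ hχc (by fun_prop)
    · exact integrable_mul_of_hasCompactSupport hχ hχc continuous_const
  rw [e]
  exact norm_integral_scale_le hχ hχc hβ hh hA (fun y _ => hfℓ _) fun y _ => hfℓ _

/-- Homogeneity of degree `1 + α` gives the factor `1 - 2 · 2^(-(1+α)) = 1 - 2^(-α)`, which is
nonzero for `α ≠ 0`: the combination that kills linear maps does not kill this term. -/
theorem scalePairing_powerNonlinearity (hh : 0 < h) {ℓ : EuclideanSpace ℝ (Fin N) → ℂ}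
    (hℓ : ∀ (r : ℝ) x, ℓ (r • x) = r * ℓ x) :
    scalePairing χ h (fun x => powerNonlinearity α (ℓ x)) =
      ((h ^ (1 + α) * (1 - 2 ^ (-α)) : ℝ) : ℂ) * ∫ y, (χ y : ℂ) * powerNonlinearity α (ℓ y) := by
  rw [scalePairing, ← integral_const_mul]
  congr with y
  rw [hℓ, hℓ, powerNonlinearity_ofReal_mul _ hh, powerNonlinearity_ofReal_mul _ (half_pos hh),
    Real.div_rpow hh.le zero_le_two, Real.rpow_add two_pos, Real.rpow_one,
    Real.rpow_neg zero_le_two]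
  have : (2 : ℝ) ^ α ≠ 0 := (Real.rpow_pos_of_pos two_pos _).ne'
  push_cast
  field_simp

/-- Replacing `f` by its linear part costs `O(h^(1+β))` by the Lipschitz bound on the ball of radius
`Bρ + Aρ^(1+β)`, which contains the values of `f` and `ℓ` on `‖x‖ ≤ ρ`. The condition `h ≤ 1` keeps
the dilated points there. -/
theorem norm_scalePairing_powerNonlinearity_sub_le (hχ : Continuous χ) (hχc : HasCompactSupport χ)
    {ρ : ℝ} (hρ : ∀ y, χ y ≠ 0 → ‖y‖ ≤ ρ) (hρ₀ : 0 ≤ ρ) (hα : 0 < α) (hα₁ : α ≤ 1) (hβ : 0 ≤ β)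
    (hh : 0 < h) (hh₁ : h ≤ 1) {A B : ℝ} (hA : 0 ≤ A) (hB : 0 ≤ B)
    {f ℓ : EuclideanSpace ℝ (Fin N) → ℂ} (hf : Continuous f) (hℓc : Continuous ℓ)
    (hℓ : ∀ (r : ℝ) x, ℓ (r • x) = r * ℓ x) (hℓB : ∀ x, ‖ℓ x‖ ≤ B * ‖x‖)
    (hfℓ : ∀ x, ‖f x - ℓ x‖ ≤ A * ‖x‖ ^ (1 + β)) :
    ‖scalePairing χ h (fun x => powerNonlinearity α (f x)) -
        ((h ^ (1 + α) * (1 - 2 ^ (-α)) : ℝ) : ℂ) *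
          ∫ y, (χ y : ℂ) * powerNonlinearity α (ℓ y)‖ ≤
      3 * (2 * (B * ρ + A * ρ ^ (1 + β)) ^ α * A) * (∫ y, |χ y| * ‖y‖ ^ (1 + β)) *
        h ^ (1 + β) := by
  have hcg := continuous_powerNonlinearity hα.le
  have e : scalePairing χ h (fun x => powerNonlinearity α (f x)) -
      scalePairing χ h (fun x => powerNonlinearity α (ℓ x)) =
      scalePairing χ h fun x => powerNonlinearity α (f x) - powerNonlinearity α (ℓ x) := by
    rw [scalePairing, scalePairing, ← integral_sub]
    · rw [scalePairing]
      congr with y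
      ring
    · exact integrable_mul_of_hasCompactSupport hχ hχc (by fun_prop)
    · exact integrable_mul_of_hasCompactSupport hχ hχc (by fun_prop)
  rw [← scalePairing_powerNonlinearity hh hℓ, e]
  have key : ∀ x, ‖x‖ ≤ ρ → ‖powerNonlinearity α (f x) - powerNonlinearity α (ℓ x)‖ ≤
      2 * (B * ρ + A * ρ ^ (1 + β)) ^ α * A * ‖x‖ ^ (1 + β) := by
    intro x hx
    have h1 : ‖ℓ x‖ ≤ B * ρ := (hℓB x).trans (by gcongr)
    have h2 : ‖f x - ℓ x‖ ≤ A * ρ ^ (1 + β) := (hfℓ x).trans (by gcongr)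
    have h3 : ‖f x‖ ≤ B * ρ + A * ρ ^ (1 + β) := by
      calc ‖f x‖ = ‖ℓ x + (f x - ℓ x)‖ := by rw [add_sub_cancel]
        _ ≤ _ := (norm_add_le _ _).trans (add_le_add h1 h2)
    have h4 : ‖ℓ x‖ ≤ B * ρ + A * ρ ^ (1 + β) := h1.trans (by
      have : 0 ≤ A * ρ ^ (1 + β) := by positivity
      linarith)
    refine (norm_powerNonlinearity_sub_le hα hα₁ h3 h4).trans ?_
    rw [mul_assoc (2 * _ ^ α)]
    gcongr
    exact hfℓ x
  refine norm_integral_scale_le hχ hχc hβ hh (by positivity) (fun y hy => key _ ?_)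
    fun y hy => key _ ?_
  · rw [norm_smul, Real.norm_of_nonneg hh.le]
    exact (mul_le_of_le_one_left (norm_nonneg _) hh₁).trans (hρ y hy)
  · rw [norm_smul, Real.norm_of_nonneg (half_pos hh).le]
    exact (mul_le_of_le_one_left (norm_nonneg _) (by linarith)).trans (hρ y hy)

/-- Used to show that the leading coefficient depends continuously on time at `t = 0`. -/
theorem norm_integral_powerNonlinearity_sub_le (hχ : Continuous χ) (hχc : HasCompactSupport χ)
    {ρ : ℝ} (hρ : ∀ y, χ y ≠ 0 → ‖y‖ ≤ ρ) (hα : 0 < α) (hα₁ : α ≤ 1)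
    {B δ : ℝ} (hB : 0 ≤ B) {ℓ ℓ' : EuclideanSpace ℝ (Fin N) → ℂ} (hℓc : Continuous ℓ)
    (hℓc' : Continuous ℓ') (hℓB : ∀ x, ‖ℓ x‖ ≤ B * ‖x‖) (hℓB' : ∀ x, ‖ℓ' x‖ ≤ B * ‖x‖)
    (hδ : ∀ x, ‖ℓ x - ℓ' x‖ ≤ δ * ‖x‖) :
    ‖(∫ y, (χ y : ℂ) * powerNonlinearity α (ℓ y)) -
        ∫ y, (χ y : ℂ) * powerNonlinearity α (ℓ' y)‖ ≤
      2 * (B * ρ) ^ α * (∫ y, |χ y| * ‖y‖) * δ := by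
  have hcg := continuous_powerNonlinearity hα.le
  have hi : Integrable fun y => |χ y| * ‖y‖ :=
    Continuous.integrable_of_hasCompactSupport (by fun_prop)
      (hχc.comp_left (g := fun x : ℝ => |x|) abs_zero).mul_right
  have e : 2 * (B * ρ) ^ α * (∫ y, |χ y| * ‖y‖) * δ =
      ∫ y, 2 * (B * ρ) ^ α * δ * (|χ y| * ‖y‖) := by
    rw [integral_const_mul]; ring
  rw [← integral_sub (integrable_mul_of_hasCompactSupport hχ hχc (by fun_prop))
    (integrable_mul_of_hasCompactSupport hχ hχc (by fun_prop)), e]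
  refine norm_integral_le_of_norm_le (hi.const_mul _) (Eventually.of_forall fun y => ?_)
  by_cases hy : χ y = 0
  · simp [hy]
  have hBρ : B * ‖y‖ ≤ B * ρ := mul_le_mul_of_nonneg_left (hρ y hy) hB
  have h0 : 0 ≤ B * ρ := le_trans (by positivity) hBρ
  have h1 := norm_powerNonlinearity_sub_le hα hα₁ ((hℓB y).trans hBρ) ((hℓB' y).trans hBρ)
  rw [← mul_sub, norm_mul, Complex.norm_real, Real.norm_eq_abs]
  calc _ ≤ |χ y| * (2 * (B * ρ) ^ α * (δ * ‖y‖)) := by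
        gcongr
        exact h1.trans (by gcongr; exact hδ y)
    _ = _ := by ring

end Scaling

/-! ### A mean value inequality and the comparison of powers -/

section Calculus

/-- The mean value inequality applied to `D t - t c`. -/
theorem norm_sub_sub_mul_le {D D' : ℝ → ℂ} {a b ε : ℝ} {c : ℂ} (hab : a ≤ b)
    (hD : ∀ t ∈ Set.Icc a b, HasDerivAt D (D' t) t) (hc : ∀ t ∈ Set.Icc a b, ‖D' t - c‖ ≤ ε) :
    ‖D b - D a - (b - a) * c‖ ≤ ε * (b - a) := by
  have h := (convex_Icc a b).norm_image_sub_le_of_norm_hasDerivWithin_le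
    (f := fun t => D t - t * c) (f' := fun t => D' t - c)
    (fun t ht => ((hD t ht).sub (by
      simpa using (Complex.ofRealCLM.hasDerivAt (x := t)).mul_const c)).hasDerivWithinAt)
    hc ⟨le_rfl, hab⟩ ⟨hab, le_rfl⟩
  rw [Real.norm_of_nonneg (sub_nonneg.2 hab)] at h
  have e : D b - D a - (b - a) * c = D b - b * c - (D a - a * c) := by ring
  rw [e]
  exact h

/-- Division by `h^(1+α)` would give `a ≤ C h^(β-α)`, which tends to `0`. -/
theorem not_forall_mul_rpow_le {a C α β : ℝ} (ha : 0 < a) (hαβ : α < β) :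
    ¬ ∀ h : ℝ, 0 < h → h ≤ 1 → a * h ^ (1 + α) ≤ C * h ^ (1 + β) := by
  intro H
  have h1 : Tendsto (fun h : ℝ => C * h ^ (β - α)) (𝓝[>] 0) (𝓝 0) := by
    have h2 : Tendsto (fun h : ℝ => h ^ (β - α)) (𝓝 0) (𝓝 0) := by
      have := (Real.continuousAt_rpow_const 0 (β - α) (Or.inr (by linarith))).tendsto
      rwa [Real.zero_rpow (by linarith)] at this
    simpa using (h2.mono_left nhdsWithin_le_nhds).const_mul C
  have h3 : ∀ᶠ h : ℝ in 𝓝[>] 0, C * h ^ (β - α) < a := h1.eventually_lt_const ha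
  have h4 : ∀ᶠ h : ℝ in 𝓝[>] 0, h ∈ Set.Ioc (0 : ℝ) 1 := Ioc_mem_nhdsGT one_pos
  obtain ⟨h, h5, h6⟩ := (h3.and h4).exists
  have h7 := H h h6.1 h6.2
  have e : C * h ^ (1 + β) = C * h ^ (β - α) * h ^ (1 + α) := by
    rw [mul_assoc, ← Real.rpow_add h6.1]; ring_nf
  rw [e] at h7
  exact absurd (le_of_mul_le_mul_right h7 (Real.rpow_pos_of_pos h6.1 _)) (not_le.2 h5)

end Calculus

/-! ### Pointwise behaviour at the origin of elements of `Hˢ` -/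

namespace SobolevSpace

variable {N : ℕ} {s β : ℝ}

/-- The continuous representative of an element of `Hˢ`. -/
def rep (hs₀ : 0 ≤ s) (u : SobolevSpace N s) : EuclideanSpace ℝ (Fin N) → ℂ :=
  𝓕⁻ (hat hs₀ u : EuclideanSpace ℝ (Fin N) → ℂ)

/-- The continuous representative of the Laplacian of an element of `Hˢ`. -/
def lapRep (hs₂ : 2 ≤ s) (u : SobolevSpace N s) : EuclideanSpace ℝ (Fin N) → ℂ :=
  𝓕⁻ (lapHat hs₂ u : EuclideanSpace ℝ (Fin N) → ℂ)

/-- The differential at the origin of an element of `Hˢ`. -/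
def diffZero (hs₀ : 0 ≤ s) (u : SobolevSpace N s) : EuclideanSpace ℝ (Fin N) → ℂ :=
  fourierInvLinearPart (hat hs₀ u)

/-- The differential at the origin of the Laplacian of an element of `Hˢ`. -/
def lapDiffZero (hs₂ : 2 ≤ s) (u : SobolevSpace N s) : EuclideanSpace ℝ (Fin N) → ℂ :=
  fourierInvLinearPart (lapHat hs₂ u)

theorem integrable_hat (hs₀ : 0 ≤ s) (hs : (N : ℝ) / 2 < s) (u : SobolevSpace N s) :
    Integrable (hat hs₀ u) := by
  obtain ⟨C, -, hC⟩ := exists_integral_hat_le (N := N) hs₀ (r := 0) (by linarith)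
  exact integrable_of_japaneseWeight_nonneg le_rfl (Lp.aestronglyMeasurable _) (hC u).1

theorem integrable_lapHat (hs₂ : 2 ≤ s) (hs : 2 + (N : ℝ) / 2 < s) (u : SobolevSpace N s) :
    Integrable (lapHat hs₂ u) := by
  obtain ⟨C, -, hC⟩ := exists_integral_hat_le (N := N) (by linarith : (0 : ℝ) ≤ s)
    (r := 0 + 2) (by linarith)
  exact integrable_of_japaneseWeight_nonneg le_rfl (Lp.aestronglyMeasurable _)
    (integrable_lapHat_and_le hs₂ u (hC u).1).1

theorem continuous_rep (hs₀ : 0 ≤ s) (hs : (N : ℝ) / 2 < s) (u : SobolevSpace N s) :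
    Continuous (rep hs₀ u) :=
  continuous_fourierInv (integrable_hat hs₀ hs u)

theorem continuous_lapRep (hs₂ : 2 ≤ s) (hs : 2 + (N : ℝ) / 2 < s) (u : SobolevSpace N s) :
    Continuous (lapRep hs₂ u) :=
  continuous_fourierInv (integrable_lapHat hs₂ hs u)

theorem lap_ae_eq_lapRep (hs₂ : 2 ≤ s) (hs : 2 + (N : ℝ) / 2 < s) (u : SobolevSpace N s) :
    lap hs₂ u =ᵐ[volume] lapRep hs₂ u :=
  fourierInv_ae_eq _ (integrable_lapHat hs₂ hs u)

theorem diffZero_smul (hs₀ : 0 ≤ s) (u : SobolevSpace N s) (r : ℝ)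
    (x : EuclideanSpace ℝ (Fin N)) : diffZero hs₀ u (r • x) = r * diffZero hs₀ u x :=
  fourierInvLinearPart_smul _ _ _

theorem diffZero_sub (hs₀ : 0 ≤ s) (hs : 1 + (N : ℝ) / 2 < s) (u v : SobolevSpace N s)
    (x : EuclideanSpace ℝ (Fin N)) :
    diffZero hs₀ u x - diffZero hs₀ v x = diffZero hs₀ (u - v) x := by
  obtain ⟨C, -, hC⟩ := exists_integral_hat_le (N := N) hs₀ (r := 1) hs
  rw [diffZero, diffZero, diffZero, fourierInvLinearPart, fourierInvLinearPart,
    fourierInvLinearPart,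
    ← integral_sub
      (integrable_fourierInvLinearPart le_rfl (Lp.aestronglyMeasurable _) (hC u).1 x)
      (integrable_fourierInvLinearPart le_rfl (Lp.aestronglyMeasurable _) (hC v).1 x)]
  refine integral_congr_ae ?_
  filter_upwards [Lp.coeFn_sub (hat hs₀ u) (hat hs₀ v)] with ξ h
  rw [map_sub, h, Pi.sub_apply]
  ring

theorem exists_norm_diffZero_le (hs₀ : 0 ≤ s) (hs : 1 + (N : ℝ) / 2 < s) :
    ∃ C : ℝ, 0 ≤ C ∧ ∀ (u : SobolevSpace N s) (x : EuclideanSpace ℝ (Fin N)),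
      ‖diffZero hs₀ u x‖ ≤ C * ‖u‖ * ‖x‖ := by
  obtain ⟨C, hC0, hC⟩ := exists_integral_hat_le (N := N) hs₀ (r := 1) hs
  have := Real.pi_pos
  refine ⟨2 * Real.pi * C, by positivity, fun u x => ?_⟩
  refine (norm_fourierInvLinearPart_le le_rfl (hC u).1 x).trans ?_
  calc _ ≤ 2 * Real.pi * ‖x‖ * (C * ‖u‖) := by gcongr; exact (hC u).2
    _ = _ := by ring

theorem continuous_diffZero (hs₀ : 0 ≤ s) (hs : 1 + (N : ℝ) / 2 < s) (u : SobolevSpace N s) :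
    Continuous (diffZero hs₀ u) := by
  obtain ⟨C, -, hC⟩ := exists_integral_hat_le (N := N) hs₀ (r := 1) hs
  refine continuous_iff_continuousAt.2 fun x => tendsto_iff_norm_sub_tendsto_zero.2 ?_
  have hsub : ∀ y, diffZero hs₀ u y - diffZero hs₀ u x = diffZero hs₀ u (y - x) := by
    intro y
    rw [diffZero, fourierInvLinearPart, fourierInvLinearPart, fourierInvLinearPart,
      ← integral_sub
        (integrable_fourierInvLinearPart le_rfl (Lp.aestronglyMeasurable _) (hC u).1 y)
        (integrable_fourierInvLinearPart le_rfl (Lp.aestronglyMeasurable _) (hC u).1 x)]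
    congr with ξ
    rw [inner_sub_right]
    push_cast
    ring
  obtain ⟨K, -, hK⟩ := exists_norm_diffZero_le (N := N) hs₀ hs
  refine squeeze_zero (fun _ => norm_nonneg _) (fun y => (hsub y ▸ hK u (y - x) :)) ?_
  have h1 : Continuous fun y => K * ‖u‖ * ‖y - x‖ := by fun_prop
  simpa using h1.tendsto x

/-- Taylor expansion at the origin. -/
theorem exists_norm_rep_sub_le (hs₀ : 0 ≤ s) (hβ₀ : 0 ≤ β) (hβ₁ : β ≤ 1)
    (hs : 1 + β + (N : ℝ) / 2 < s) :
    ∃ C : ℝ, 0 ≤ C ∧ ∀ (u : SobolevSpace N s) (x : EuclideanSpace ℝ (Fin N)),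
      ‖rep hs₀ u x - rep hs₀ u 0 - diffZero hs₀ u x‖ ≤ C * ‖u‖ * ‖x‖ ^ (1 + β) := by
  obtain ⟨C, hC0, hC⟩ := exists_integral_hat_le (N := N) hs₀ (r := 1 + β) hs
  have := Real.pi_pos
  refine ⟨3 * (2 * Real.pi) ^ (1 + β) * C, by positivity, fun u x => ?_⟩
  refine (norm_fourierInv_sub_le hβ₀ hβ₁ (Lp.aestronglyMeasurable _) (hC u).1 x).trans ?_
  calc _ ≤ 3 * (2 * Real.pi) ^ (1 + β) * ‖x‖ ^ (1 + β) * (C * ‖u‖) := by gcongr; exact (hC u).2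
    _ = _ := by ring

/-- Two orders of weight pay for the Laplacian and `1 + β` for the expansion; together with the
`N/2` lost to Cauchy–Schwarz this is the source of the threshold on `s`. -/
theorem exists_norm_lapRep_sub_le (hs₂ : 2 ≤ s) (hβ₀ : 0 ≤ β) (hβ₁ : β ≤ 1)
    (hs : 3 + β + (N : ℝ) / 2 < s) :
    ∃ C : ℝ, 0 ≤ C ∧ ∀ (u : SobolevSpace N s) (x : EuclideanSpace ℝ (Fin N)),
      ‖lapRep hs₂ u x - lapRep hs₂ u 0 - lapDiffZero hs₂ u x‖ ≤ C * ‖u‖ * ‖x‖ ^ (1 + β) := by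
  obtain ⟨C, hC0, hC⟩ := exists_integral_hat_le (N := N) (by linarith : (0 : ℝ) ≤ s)
    (r := 1 + β + 2) (by linarith)
  have := Real.pi_pos
  refine ⟨3 * (2 * Real.pi) ^ (1 + β) * ((2 * Real.pi) ^ 2 * C), by positivity, fun u x => ?_⟩
  have h := integrable_lapHat_and_le hs₂ u (hC u).1
  refine (norm_fourierInv_sub_le hβ₀ hβ₁ (Lp.aestronglyMeasurable _) h.1 x).trans ?_
  calc _ ≤ 3 * (2 * Real.pi) ^ (1 + β) * ‖x‖ ^ (1 + β) * ((2 * Real.pi) ^ 2 * (C * ‖u‖)) := by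
        gcongr
        exact h.2.trans (by gcongr; exact (hC u).2)
    _ = _ := by ring

/-- Ensures that the Taylor expansion at the origin starts with the linear term, so that the
nonlinearity is evaluated near its singular point. -/
theorem rep_zero_of_odd (hs₀ : 0 ≤ s) (hs : (N : ℝ) / 2 < s) {u : SobolevSpace N s}
    (hu : toL2 u + reflect (toL2 u) = 0) : rep hs₀ u 0 = 0 := by
  have hc := continuous_rep hs₀ hs u
  have hae : (fun x => rep hs₀ u x + rep hs₀ u (-x)) =ᵐ[volume] fun _ => 0 := by
    have h1 : toL2 u =ᵐ[volume] rep hs₀ u := toL2_ae_eq_fourierInv hs₀ hs u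
    have hn := (Measure.measurePreserving_neg
      (volume : Measure (EuclideanSpace ℝ (Fin N)))).quasiMeasurePreserving.ae h1
    have h0 : (toL2 u + reflect (toL2 u) : L2 N) =ᵐ[volume] 0 := by
      rw [hu]; exact Lp.coeFn_zero _ _ _
    filter_upwards [h1, hn, h0, coeFn_reflect (toL2 u),
      Lp.coeFn_add (toL2 u) (reflect (toL2 u))] with x h2 h3 h4 h5 h6
    rw [← h2, ← h3, ← h5, ← Pi.add_apply, ← h6, h4, Pi.zero_apply]
  have h := congrFun ((Continuous.ae_eq_iff_eq volume (by fun_prop) continuous_const).1 hae) 0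
  simp only [neg_zero] at h
  exact add_self_eq_zero.1 h

end SobolevSpace

/-! ### The contradiction -/

section Main

open SobolevSpace

variable {N : ℕ} {s α β θ T : ℝ} {lam : ℂ} {φ : EuclideanSpace ℝ (Fin N) → ℂ}
  {u : ℝ → SobolevSpace N s}

/-- The equation tested against the rescaled test functions. -/
theorem IsSolution.hasDerivAt_scalePairing (h : IsSolution N s α θ lam φ T u) (hα : 0 < α)
    (hs₀ : 0 ≤ s) (hs₂ : 2 ≤ s) (hs : 2 + (N : ℝ) / 2 < s)
    {χ : EuclideanSpace ℝ (Fin N) → ℝ} (hχ : ContDiff ℝ ∞ χ) (hχc : HasCompactSupport χ)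
    {r : ℝ} (hr : 0 < r) {t : ℝ} (ht : t ∈ Set.Ioo 0 T) :
    HasDerivAt (fun τ => scalePairing χ r (rep hs₀ (u τ)))
      (Complex.exp (Complex.I * θ) * scalePairing χ r (lapRep hs₂ (u t)) +
        lam * scalePairing χ r fun x => powerNonlinearity α (rep hs₀ (u t) x)) t := by
  obtain ⟨ψ, hψ⟩ := exists_schwartz_integral_eq_scalePairing hχ hχc hr
  have hs' : (N : ℝ) / 2 < s := by linarith
  have hcg := continuous_powerNonlinearity hα.le
  have e1 : ∀ τ, scalePairing χ r (rep hs₀ (u τ)) = Lp.toTemperedDistribution (toL2 (u τ)) ψ := by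
    intro τ
    rw [← hψ _ (continuous_rep hs₀ hs' _), Lp.toTemperedDistribution_apply]
    refine integral_congr_ae ?_
    filter_upwards [toL2_ae_eq_fourierInv hs₀ hs' (u τ)] with x hx
    rw [hx]; rfl
  have e2 : scalePairing χ r (lapRep hs₂ (u t)) = Lp.toTemperedDistribution (lap hs₂ (u t)) ψ := by
    rw [← hψ _ (continuous_lapRep hs₂ hs _), Lp.toTemperedDistribution_apply]
    refine integral_congr_ae ?_
    filter_upwards [lap_ae_eq_lapRep hs₂ hs (u t)] with x hx
    rw [hx]; rfl
  have e3 : (scalePairing χ r fun x => powerNonlinearity α (rep hs₀ (u t) x)) =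
      ∫ x, ((‖toL2 (u t) x‖ ^ α : ℝ) : ℂ) * toL2 (u t) x * ψ x := by
    rw [← hψ (fun x => powerNonlinearity α (rep hs₀ (u t) x))
      (hcg.comp (continuous_rep hs₀ hs' _))]
    refine integral_congr_ae ?_
    filter_upwards [toL2_ae_eq_fourierInv hs₀ hs' (u t)] with x hx
    rw [hx, mul_comm]; rfl
  simp only [e1, e2, e3, ← laplacian_toTemperedDistribution_toL2]
  exact h.equation t ht ψ

/-- If an odd initial value has a nonzero differential at the origin, then the loss of regularity
of the nonlinearity prevents the existence of a solution. -/
theorem not_isSolution_of_odd (hα : 0 < α) (hαβ : α < β) (hβ₁ : β ≤ 1) (hlam : lam ≠ 0)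
    (hθ : 0 ≤ Real.cos θ) (hs : 3 + β + (N : ℝ) / 2 < s) (hφ : ∀ x, φ (-x) = -φ x) (hT : 0 < T)
    {χ : EuclideanSpace ℝ (Fin N) → ℝ} (hχ : ContDiff ℝ ∞ χ) (hχc : HasCompactSupport χ)
    (hodd : ∀ x, χ (-x) = -χ x)
    (h : IsSolution N s α θ lam φ T u) (hs₀ : 0 ≤ s)
    (hI : (∫ y, (χ y : ℂ) * powerNonlinearity α (diffZero hs₀ (u 0) y)) ≠ 0) : False := by
  have hN : (0 : ℝ) ≤ N := Nat.cast_nonneg N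
  have hs₂ : 2 ≤ s := by linarith
  have hβ₀ : 0 ≤ β := by linarith
  have hα₁ : α ≤ 1 := by linarith
  set I : ℝ → ℂ := fun t => ∫ y, (χ y : ℂ) * powerNonlinearity α (diffZero hs₀ (u t) y) with hIdef
  have hI0 : 0 < ‖I 0‖ := norm_pos_iff.2 hI
  obtain ⟨ρ, hρ₀, hρ'⟩ : ∃ ρ : ℝ, 0 ≤ ρ ∧ ∀ y, χ y ≠ 0 → ‖y‖ ≤ ρ := by
    obtain ⟨ρ, hρ⟩ := hχc.isCompact.isBounded.exists_norm_le
    exact ⟨max ρ 0, le_max_right _ _, fun y hy =>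
      (hρ y (subset_tsupport _ hy)).trans (le_max_left _ _)⟩
  obtain ⟨B, hB'⟩ := isCompact_Icc.exists_bound_of_continuousOn h.continuousOn
  have hB₀ : 0 ≤ B := (norm_nonneg _).trans (hB' 0 ⟨le_rfl, hT.le⟩)
  obtain ⟨C₁, hC₁, hu₁⟩ := exists_norm_diffZero_le (N := N) hs₀ (by linarith)
  obtain ⟨C₂, hC₂, hu₂⟩ := exists_norm_rep_sub_le (N := N) hs₀ hβ₀ hβ₁ (by linarith)
  obtain ⟨C₃, hC₃, hu₃⟩ := exists_norm_lapRep_sub_le (N := N) hs₂ hβ₀ hβ₁ hs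
  have hd : ∀ t ∈ Set.Icc 0 T, ∀ x, ‖diffZero hs₀ (u t) x‖ ≤ C₁ * B * ‖x‖ := fun t ht x =>
    (hu₁ (u t) x).trans (by gcongr; exact hB' t ht)
  have hr : ∀ t ∈ Set.Icc 0 T, ∀ x, ‖rep hs₀ (u t) x - rep hs₀ (u t) 0 - diffZero hs₀ (u t) x‖ ≤
      C₂ * B * ‖x‖ ^ (1 + β) := fun t ht x =>
    (hu₂ (u t) x).trans (by gcongr; exact hB' t ht)
  have hl : ∀ t ∈ Set.Icc 0 T, ∀ x, ‖lapRep hs₂ (u t) x - lapRep hs₂ (u t) 0 -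
      lapDiffZero hs₂ (u t) x‖ ≤ C₃ * B * ‖x‖ ^ (1 + β) := fun t ht x =>
    (hu₃ (u t) x).trans (by gcongr; exact hB' t ht)
  have hzero : ∀ t ∈ Set.Icc 0 T, rep hs₀ (u t) 0 = 0 := fun t ht =>
    rep_zero_of_odd hs₀ (by linarith)
      (h.add_reflect_eq_zero hα hα₁ hθ hs₂ (by linarith) hφ t ht)
  have hlin := fun t => continuous_diffZero hs₀ (by linarith) (u t)
  -- The window `[t₀/2, t₀]` lies inside the open interval where the equation holds, yet close
  -- enough to `0` for the leading coefficient `I t` to stay within half of `‖I 0‖`.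
  obtain ⟨t₀, ht₀, ht₀T, hIt⟩ : ∃ t₀ : ℝ, 0 < t₀ ∧ t₀ < T ∧
      ∀ t ∈ Set.Icc (t₀ / 2) t₀, ‖I t - I 0‖ ≤ ‖I 0‖ / 2 := by
    set J := 2 * (C₁ * B * ρ) ^ α * (∫ y, |χ y| * ‖y‖) with hJ
    have hIle : ∀ t ∈ Set.Icc 0 T, ‖I t - I 0‖ ≤ J * (C₁ * ‖u t - u 0‖) := fun t ht =>
      norm_integral_powerNonlinearity_sub_le hχ.continuous hχc hρ' hα hα₁ (by positivity)
        (hlin t) (hlin 0) (hd t ht) (hd 0 ⟨le_rfl, hT.le⟩) fun x => by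
          rw [diffZero_sub hs₀ (by linarith)]
          exact hu₁ _ x
    have h1 : Tendsto (fun t => J * (C₁ * ‖u t - u 0‖)) (𝓝[Set.Icc 0 T] 0) (𝓝 0) := by
      have := tendsto_iff_norm_sub_tendsto_zero.1 (h.continuousOn 0 ⟨le_rfl, hT.le⟩)
      simpa using (this.const_mul C₁).const_mul J
    have h2 : ∀ᶠ t in 𝓝[Set.Icc 0 T] (0 : ℝ), J * (C₁ * ‖u t - u 0‖) < ‖I 0‖ / 2 :=
      h1.eventually_lt_const (half_pos hI0)
    obtain ⟨ε, hε, hε'⟩ := Metric.mem_nhdsWithin_iff.1 h2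
    have hm : 0 < min ε T := lt_min hε hT
    have hmε := min_le_left ε T
    have hmT := min_le_right ε T
    refine ⟨min ε T / 2, by linarith, by linarith, fun t ht => ?_⟩
    have htT : t ∈ Set.Icc 0 T := ⟨by linarith [ht.1], by linarith [ht.2]⟩
    refine (hIle t htT).trans (le_of_lt (hε' ⟨?_, htT⟩))
    rw [Metric.mem_ball, Real.dist_eq, sub_zero, abs_of_nonneg htT.1]
    linarith [ht.2]
  set κ : ℝ := 1 - 2 ^ (-α) with hκ
  have hκ₀ : 0 < κ := sub_pos.2 (Real.rpow_lt_one_of_one_lt_of_neg one_lt_two (by linarith))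
  set K := ∫ y, |χ y| * ‖y‖ ^ (1 + β) with hK
  set D₁ := 3 * (C₂ * B) * K with hD₁
  set D₂ := 3 * (C₃ * B) * K with hD₂
  set D₃ := 3 * (2 * (C₁ * B * ρ + C₂ * B * ρ ^ (1 + β)) ^ α * (C₂ * B)) * K with hD₃
  have hl₀ : 0 < ‖lam‖ := norm_pos_iff.2 hlam
  have hsub : ∀ t ∈ Set.Icc (t₀ / 2) t₀, t ∈ Set.Ioo 0 T := fun t ht =>
    ⟨by linarith [ht.1], by linarith [ht.2]⟩
  -- Over a window of length `t₀/2` the leading term is `‖lam‖ κ ‖I 0‖ t₀/2`, and the variation of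
  -- `I` consumes at most half of it. `C` collects the two endpoint values and the error in the
  -- derivative.
  refine not_forall_mul_rpow_le (a := ‖lam‖ * κ * ‖I 0‖ * t₀ / 4)
    (C := 2 * D₁ + (D₂ + ‖lam‖ * D₃) * (t₀ / 2)) (by positivity) hαβ fun r hr0 hr1 => ?_
  have hr0' : ∀ t ∈ Set.Icc 0 T, ‖scalePairing χ r (rep hs₀ (u t))‖ ≤ D₁ * r ^ (1 + β) :=
    fun t ht => norm_scalePairing_le hχ.continuous hχc hodd hβ₀ hr0 (by positivity)
      (continuous_rep hs₀ (by linarith) _) (diffZero_smul hs₀ _) (hr t ht)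
  -- The derivative is compared with a constant in time, so that the leading contributions cannot
  -- cancel under integration.
  have hderiv : ∀ t ∈ Set.Icc (t₀ / 2) t₀,
      ‖(Complex.exp (Complex.I * θ) * scalePairing χ r (lapRep hs₂ (u t)) +
        lam * scalePairing χ r fun x => powerNonlinearity α (rep hs₀ (u t) x)) -
        lam * (((r ^ (1 + α) * κ : ℝ) : ℂ) * I 0)‖ ≤
      (D₂ + ‖lam‖ * D₃) * r ^ (1 + β) + ‖lam‖ * (r ^ (1 + α) * κ) * (‖I 0‖ / 2) := by
    intro t ht
    have htT : t ∈ Set.Icc 0 T := Set.Ioo_subset_Icc_self (hsub t ht)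
    have h1 : ‖scalePairing χ r (lapRep hs₂ (u t))‖ ≤ D₂ * r ^ (1 + β) :=
      norm_scalePairing_le hχ.continuous hχc hodd hβ₀ hr0 (by positivity)
        (continuous_lapRep hs₂ (by linarith) _) (fun _ _ => fourierInvLinearPart_smul _ _ _)
        (hl t htT)
    have h2 : ‖(scalePairing χ r fun x => powerNonlinearity α (rep hs₀ (u t) x)) -
        ((r ^ (1 + α) * κ : ℝ) : ℂ) * I t‖ ≤ D₃ * r ^ (1 + β) :=
      norm_scalePairing_powerNonlinearity_sub_le hχ.continuous hχc hρ' hρ₀ hα hα₁ hβ₀ hr0 hr1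
        (by positivity) (by positivity) (continuous_rep hs₀ (by linarith) _) (hlin t)
        (diffZero_smul hs₀ _) (hd t htT) fun x => by simpa [hzero t htT] using hr t htT x
    have h3 := hIt t ht
    have h4 : ‖((r ^ (1 + α) * κ : ℝ) : ℂ)‖ = r ^ (1 + α) * κ := by
      rw [Complex.norm_real, Real.norm_of_nonneg (by positivity)]
    have h5 : ‖Complex.exp (Complex.I * θ)‖ = 1 := by
      rw [mul_comm]; exact Complex.norm_exp_ofReal_mul_I θ
    have e : (Complex.exp (Complex.I * θ) * scalePairing χ r (lapRep hs₂ (u t)) +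
        lam * scalePairing χ r fun x => powerNonlinearity α (rep hs₀ (u t) x)) -
        lam * (((r ^ (1 + α) * κ : ℝ) : ℂ) * I 0) =
        Complex.exp (Complex.I * θ) * scalePairing χ r (lapRep hs₂ (u t)) +
        lam * ((scalePairing χ r fun x => powerNonlinearity α (rep hs₀ (u t) x)) -
          ((r ^ (1 + α) * κ : ℝ) : ℂ) * I t) +
        lam * ((r ^ (1 + α) * κ : ℝ) : ℂ) * (I t - I 0) := by ring
    rw [e]
    refine norm_add₃_le.trans ?_
    rw [norm_mul, norm_mul, norm_mul, norm_mul, h4, h5, one_mul]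
    calc _ ≤ D₂ * r ^ (1 + β) + ‖lam‖ * (D₃ * r ^ (1 + β)) +
          ‖lam‖ * (r ^ (1 + α) * κ) * (‖I 0‖ / 2) := by gcongr
      _ = _ := by ring
  have hmv := norm_sub_sub_mul_le (D := fun t => scalePairing χ r (rep hs₀ (u t)))
    (by linarith : t₀ / 2 ≤ t₀)
    (fun t ht => h.hasDerivAt_scalePairing hα hs₀ hs₂ (by linarith) hχ hχc hr0 (hsub t ht)) hderiv
  have e₁ := hr0' t₀ ⟨ht₀.le, ht₀T.le⟩
  have e₂ := hr0' (t₀ / 2) ⟨by linarith, by linarith⟩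
  have e₃ : ‖((t₀ : ℂ) - ((t₀ / 2 : ℝ) : ℂ)) * (lam * (((r ^ (1 + α) * κ : ℝ) : ℂ) * I 0))‖ =
      t₀ / 2 * (‖lam‖ * (r ^ (1 + α) * κ * ‖I 0‖)) := by
    rw [← Complex.ofReal_sub, norm_mul, norm_mul, norm_mul, Complex.norm_real, Complex.norm_real,
      Real.norm_of_nonneg (by linarith : 0 ≤ t₀ - t₀ / 2), Real.norm_of_nonneg (by positivity)]
    ring
  have e₄ := norm_sub_norm_le
    (((t₀ : ℂ) - ((t₀ / 2 : ℝ) : ℂ)) * (lam * (((r ^ (1 + α) * κ : ℝ) : ℂ) * I 0)))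
    (scalePairing χ r (rep hs₀ (u t₀)) - scalePairing χ r (rep hs₀ (u (t₀ / 2))))
  rw [norm_sub_rev (((t₀ : ℂ) - ((t₀ / 2 : ℝ) : ℂ)) * _), e₃] at e₄
  have e₅ := norm_sub_le (scalePairing χ r (rep hs₀ (u t₀)))
    (scalePairing χ r (rep hs₀ (u (t₀ / 2))))
  have e₆ := e₄.trans hmv
  nlinarith [e₆, e₅, e₁, e₂]

/-- The linear part at the origin is determined by the values near the origin. -/
theorem diffZero_eq_of_rep_eq (hs₀ : 0 ≤ s) (hβ₀ : 0 < β) (hβ₁ : β ≤ 1)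
    (hs : 1 + β + (N : ℝ) / 2 < s) {v : SobolevSpace N s} {ℓ : EuclideanSpace ℝ (Fin N) → ℂ}
    (hℓ : ∀ (r : ℝ) x, ℓ (r • x) = r * ℓ x)
    (hv : ∀ᶠ x in 𝓝 0, rep hs₀ v x = ℓ x) (x : EuclideanSpace ℝ (Fin N)) :
    diffZero hs₀ v x = ℓ x := by
  obtain ⟨C, -, hC⟩ := exists_norm_rep_sub_le (N := N) hs₀ hβ₀.le hβ₁ hs
  have h0 : rep hs₀ v 0 = 0 := by
    have := hℓ 0 0
    rw [zero_smul, Complex.ofReal_zero, zero_mul] at this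
    rw [hv.self_of_nhds, this]
  have h1 : Tendsto (fun r : ℝ => r • x) (𝓝[>] 0) (𝓝 0) := by
    have : Continuous fun r : ℝ => r • x := by fun_prop
    simpa using (this.tendsto 0).mono_left nhdsWithin_le_nhds
  -- Both linear parts are compared along the ray `r • x`; dividing the Taylor remainder by `r`
  -- leaves `r^β → 0`.
  have h2 : ∀ᶠ r : ℝ in 𝓝[>] 0, ‖ℓ x - diffZero hs₀ v x‖ ≤ C * ‖v‖ * ‖x‖ ^ (1 + β) * r ^ β := by
    filter_upwards [h1.eventually hv, self_mem_nhdsWithin] with r h3 (hr : 0 < r)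
    have h4 := hC v (r • x)
    rw [h3, h0, hℓ, diffZero_smul, sub_zero, ← mul_sub, norm_mul, Complex.norm_real, norm_smul,
      Real.norm_of_nonneg hr.le, Real.mul_rpow hr.le (norm_nonneg _), Real.rpow_add hr,
      Real.rpow_one] at h4
    refine le_of_mul_le_mul_left (h4.trans_eq ?_) hr
    ring
  have h5 : Tendsto (fun r : ℝ => C * ‖v‖ * ‖x‖ ^ (1 + β) * r ^ β) (𝓝[>] 0) (𝓝 0) := by
    have : Tendsto (fun r : ℝ => r ^ β) (𝓝[>] 0) (𝓝 (0 ^ β)) :=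
      (Real.continuousAt_rpow_const 0 β (Or.inr hβ₀.le)).tendsto.mono_left nhdsWithin_le_nhds
    rw [Real.zero_rpow hβ₀.ne'] at this
    simpa using this.const_mul (C * ‖v‖ * ‖x‖ ^ (1 + β))
  have h6 := ge_of_tendsto h5 h2
  exact (sub_eq_zero.1 (norm_le_zero_iff.1 h6)).symm

end Main

end GinzburgLandau

end

/-! ### The explicit initial value -/

theorem theorem3p1 (N : ℕ) (hN : 1 ≤ N) (α θ s : ℝ) (lam : ℂ)
    (hα₀ : 0 < α) (hα₁ : α < 1) (hlam : lam ≠ 0)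
    (hθ₀ : -(Real.pi / 2) ≤ θ) (hθ₁ : θ ≤ Real.pi / 2)
    (hs : 3 + (N : ℝ) / 2 + α < s) :
    ∃ φ : EuclideanSpace ℝ (Fin N) → ℂ, ContDiff ℝ ∞ φ ∧ HasCompactSupport φ ∧
      ¬ ∃ T : ℝ, 0 < T ∧ ∃ u : ℝ → GinzburgLandau.SobolevSpace N s,
        GinzburgLandau.IsSolution N s α θ lam φ T u := by
  open GinzburgLandau GinzburgLandau.SobolevSpace MeasureTheory Filter Topology in
  -- The strict inequalities on `s` and `α < 1` leave room for a regularity `β` strictly better than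
  -- that of the nonlinearity.
  obtain ⟨β, hαβ, hβ⟩ : ∃ β, α < β ∧ β < min 1 (s - 3 - N / 2) :=
    exists_between (lt_min hα₁ (by linarith))
  have hβ₁ : β < 1 := hβ.trans_le (min_le_left _ _)
  have hβs : 3 + β + (N : ℝ) / 2 < s := by linarith [hβ.trans_le (min_le_right _ _)]
  have hN₀ : (0 : ℝ) ≤ N := Nat.cast_nonneg N
  have hs₀ : 0 ≤ s := by linarith
  have hcos : 0 ≤ Real.cos θ := Real.cos_nonneg_of_mem_Icc ⟨by linarith, hθ₁⟩
  let i₀ : Fin N := ⟨0, hN⟩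
  let b : ContDiffBump (0 : EuclideanSpace ℝ (Fin N)) := ⟨1, 2, one_pos, one_lt_two⟩
  -- The same odd function serves as initial value and as test profile; near the origin it is the
  -- coordinate `x i₀`. A coordinate exists because `N ≥ 1`.
  let χ : EuclideanSpace ℝ (Fin N) → ℝ := fun x => x i₀ * b x
  have hproj : ContDiff ℝ ∞ fun x : EuclideanSpace ℝ (Fin N) => x i₀ :=
    (EuclideanSpace.proj (𝕜 := ℝ) i₀).contDiff
  have hχ : ContDiff ℝ ∞ χ := hproj.mul b.contDiff
  have hχc : HasCompactSupport χ := b.hasCompactSupport.mul_left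
  have hodd : ∀ x, χ (-x) = -χ x := fun x => by
    simp [χ, b.neg]
  refine ⟨fun x => (χ x : ℂ), Complex.ofRealCLM.contDiff.comp hχ,
    hχc.comp_left (g := ((↑) : ℝ → ℂ)) Complex.ofReal_zero, ?_⟩
  rintro ⟨T, hT, u, h⟩
  have hrep : rep hs₀ (u 0) = fun x => (χ x : ℂ) := by
    refine (Continuous.ae_eq_iff_eq volume (continuous_rep hs₀ (by linarith) _)
      (Complex.continuous_ofReal.comp hχ.continuous)).1 ?_
    filter_upwards [toL2_ae_eq_fourierInv hs₀ (by linarith) (u 0), h.initial] with x h1 h2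
    exact h1.symm.trans h2
  have hd : ∀ x, diffZero hs₀ (u 0) x = ((x i₀ : ℝ) : ℂ) := by
    refine diffZero_eq_of_rep_eq (β := β) hs₀ (by linarith) hβ₁.le (by linarith)
      (fun r x => by simp) ?_
    rw [hrep]
    filter_upwards [b.eventuallyEq_one] with x hx
    simp [χ, hx]
  refine not_isSolution_of_odd hα₀ hαβ hβ₁.le hlam hcos hβs (fun x => by simp [hodd]) hT hχ hχc
    hodd h hs₀ ?_
  -- The factor `y i₀` of `χ` combines with the one in the nonlinearity into a square, so the
  -- integrand is nonnegative.
  have e : ∀ y, (χ y : ℂ) * powerNonlinearity α (diffZero hs₀ (u 0) y) =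
      ((|y i₀| ^ α * (y i₀) ^ 2 * b y : ℝ) : ℂ) := fun y => by
    rw [hd, powerNonlinearity, Complex.norm_real, Real.norm_eq_abs]
    simp only [χ]
    push_cast
    ring
  simp only [e]
  rw [integral_complex_ofReal]
  refine Complex.ofReal_ne_zero.2 (ne_of_gt ?_)
  -- The unit vector along `i₀` lies in the closed inner ball of the bump, where `b = 1`, so the
  -- integrand equals 1 there.
  refine Continuous.integral_pos_of_hasCompactSupport_nonneg_nonzero
    (x := EuclideanSpace.single i₀ (1 : ℝ)) ?_ b.hasCompactSupport.mul_left
    (fun y => mul_nonneg (by positivity) b.nonneg) ?_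
  · exact ((hproj.continuous.abs.rpow_const fun _ => Or.inr hα₀.le).mul
      (hproj.continuous.pow 2)).mul b.continuous
  · have hb : b (EuclideanSpace.single i₀ (1 : ℝ)) = 1 :=
      b.one_of_mem_closedBall (by simp [b])
    simp [hb]
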